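/- Let $d\ge 3$, and let $\Omega_n$ be the probability space of bipartite multigraphs on $V_1\cup V_2$, $|V_1|=|V_2|=n$, obtained as the union of $d$ independent uniformly random perfect matchings between $V_1$ and $V_2$. For even $i\ge 2$ let $X_i$ be the number of cycles of length $i$ (a cycle of length $2$ is a pair of parallel edges), let $r(d,i)$ be the number of proper edge colourings of a cycle of length $i$ with $d$ colours, and put $\lambda_i=r(d,i)/i$. Let $\alpha,\beta\ge 0$ with $\alpha+\beta<1$ be such that $\alpha n$ and $\beta n$ are integers for infinitely many $n$; below, limits of quantities that involve $Y$ are taken along these $n$. Let $Y$ be the number of independent sets with exactly $\alpha n$ vertices in $V_1$ and $\beta n$ vertices in $V_2$, and put $$\delta_i=\left(\frac{\alpha\beta}{(1-\alpha)(1-\beta)}\right)^{i/2}.$$ (a) For each $k\ge 1$, $X_2,X_4,\dots,X_{2k}$ are asymptotically independent Poisson variables as $n\to\infty$, with $\mathbf E X_{2j}\to\lambda_{2j}$; that is, $\mathbf P(X_2=a_1,\dots,X_{2k}=a_k)\to\prod_{j=1}^k e^{-\lambda_{2j}}\lambda_{2j}^{a_j}/a_j!$ for all integers $a_1,\dots,a_k\ge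 0$. (b) For every even $i\ge 2$, $\mathbf E(YX_i)/\mathbf E Y\to\lambda_i(1+\delta_i)$. Moreover $1+\delta_i=\frac12 x^i\,\mathrm{tr}(A^i)$, where $x=\frac{1-\alpha-\beta}{\sqrt{(1-\alpha)(1-\beta)}}$, $y=\frac{\alpha(1-\alpha)}{(1-\alpha-\beta)^2}$, $z=\frac{\beta(1-\beta)}{(1-\alpha-\beta)^2}$ and $$A=\begin{pmatrix}0&0&0&1\\0&0&y&1\\0&1&0&0\\z&1&0&0\end{pmatrix}.$$ (c) For all integers $m_1,\dots,m_k\ge 0$, with $[x]_m=x(x-1)\cdots(x-m+1)$, $$\frac{\mathbf E\big(Y[X_2]_{m_1}\cdots[X_{2k}]_{m_k}\big)}{\mathbf E Y}\to\prod_{j=1}^k\big(\lambda_{2j}(1+\delta_{2j})\big)^{m_j}.$$ (d) Suppose in addition that $\alpha,\beta$ are such that $\mathbf E[Y^2]/(\mathbf E Y)^2\to\tau$, where $$\tau=\frac{(1-\alpha-\beta+\alpha\beta)^d}{(1-\alpha-\beta+2\alpha\beta)^{(d-1)/2}(1-\alpha-\beta)^{(d-1)/2}\sqrt{1-\alpha-\beta+d\alpha\beta}\,\sqrt{1-\alpha-\beta-(d-2)\alpha\beta}}$$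 (with $\sqrt{1-\alpha-\beta-(d-2)\alpha\beta}$ real and positive). Then $Y$ and $(X_i)_{i\text{ even}}$ satisfy all hypotheses of the small subgraph conditioning theorem with these $\lambda_i$ and $\delta_i$: $\lambda_i>0$, $\delta_i>-1$, $Y\ge 0$, $\mathbf E Y>0$ for all large $n$, (a) and (c) hold along the admissible $n$, $\sum_{i\text{ even}}\lambda_i\delta_i^2<\infty$, and $\mathbf E[Y^2]/(\mathbf E Y)^2\le\exp\big(\sum_{i\text{ even}}\lambda_i\delta_i^2\big)+o(1)$. -/

import Mathlib

open Filter Topology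
open scoped BigOperators

noncomputable section

namespace BipartiteHardCore

/-- The sample space of the random bipartite `d`-regular multigraph on `V₁ = V₂ = Fin n`: a point is
a `d`-tuple of perfect matchings, the `k`-th of which joins `u ∈ V₁` to `σ k u ∈ V₂`. It carries the
uniform distribution, so expectations are the averages `𝔼 σ, f σ`. -/
abbrev Matchings (d n : ℕ) : Type := Fin d → Equiv.Perm (Fin n)

/-- The edges of the multigraph: `(k, u)` is the edge of the `k`-th matching at `u ∈ V₁`. -/
abbrev Edge (d n : ℕ) : Type := Fin d × Fin n

/-- The two endpoints of an edge; `Sum.inl` is `V₁` and `Sum.inr` is `V₂`. -/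
def ends {d n : ℕ} (σ : Matchings d n) (e : Edge d n) : Sym2 (Fin n ⊕ Fin n) :=
  s(Sum.inl e.2, Sum.inr (σ e.1 e.2))

/-- `C` is the edge set of a cycle of length `ℓ`: there are distinct vertices `v₀, …, v_{ℓ-1}` and
distinct edges `e₀, …, e_{ℓ-1}` with `e_t` joining `v_t` and `v_{t+1 mod ℓ}`, and `C` is the set of
the `e_t`. In particular a cycle of length two is a pair of parallel edges. -/
def IsCycle {d n : ℕ} (σ : Matchings d n) (ℓ : ℕ) (C : Finset (Edge d n)) : Prop :=
  ∃ (v : Fin ℓ → Fin n ⊕ Fin n) (e : Fin ℓ → Edge d n),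
    Function.Injective v ∧ Function.Injective e ∧
    (∀ t, ends σ (e t) = s(v t, v (finRotate ℓ t))) ∧
    C = Finset.univ.image e

/-- The number of cycles of length `ℓ`. -/
def numCycles {d n : ℕ} (ℓ : ℕ) (σ : Matchings d n) : ℕ :=
  {C : Finset (Edge d n) | IsCycle σ ℓ C}.ncard

/-- The number of independent sets `S ∪ T`, `S ⊆ V₁`, `T ⊆ V₂`, with `|S| = α n` and `|T| = β n`. -/
def numIndep {d n : ℕ} (α β : ℝ) (σ : Matchings d n) : ℕ :=
  {p : Finset (Fin n) × Finset (Fin n) |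
    (p.1.card : ℝ) = α * n ∧ (p.2.card : ℝ) = β * n ∧
      ∀ k, ∀ u ∈ p.1, σ k u ∉ p.2}.ncard

/-- The `n` for which `α n` and `β n` are both (nonnegative) integers. -/
def admissible (α β : ℝ) : Set ℕ :=
  {n | ∃ a b : ℕ, (a : ℝ) = α * n ∧ (b : ℝ) = β * n}

/-- `n → ∞` through the admissible values. -/
def admissibleAtTop (α β : ℝ) : Filter ℕ := atTop ⊓ 𝓟 (admissible α β)

/-- `r(d, ℓ)`: the number of proper edge colourings of a cycle of length `ℓ` with `d` colours. -/
def properColorings (d ℓ : ℕ) : ℕ :=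
  Fintype.card {c : Fin ℓ → Fin d // ∀ t, c t ≠ c (finRotate ℓ t)}

/-- `λ_ℓ = r(d, ℓ) / ℓ`. -/
def lam (d ℓ : ℕ) : ℝ := (properColorings d ℓ : ℝ) / ℓ

/-- `δ_ℓ = (αβ / ((1-α)(1-β)))^{ℓ/2}`, used for even `ℓ`. -/
def del (α β : ℝ) (ℓ : ℕ) : ℝ := (α * β / ((1 - α) * (1 - β))) ^ (ℓ / 2)

/-- The factor `x` per step of the cycle. -/
def stepWeight (α β : ℝ) : ℝ := (1 - α - β) / √((1 - α) * (1 - β))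

/-- The transfer matrix; the states are black in `V₁`, white in `V₁`, black in `V₂`, white in `V₂`. -/
def transferMatrix (α β : ℝ) : Matrix (Fin 4) (Fin 4) ℝ :=
  let y := α * (1 - α) / (1 - α - β) ^ 2
  let z := β * (1 - β) / (1 - α - β) ^ 2
  !![0, 0, 0, 1;
     0, 0, y, 1;
     0, 1, 0, 0;
     z, 1, 0, 0]

/-- The limiting ratio of the second moment to the square of the first moment. -/
def tau (d : ℕ) (α β : ℝ) : ℝ :=
  (1 - α - β + α * β) ^ d /
    ((1 - α - β + 2 * α * β) ^ (((d : ℝ) - 1) / 2) * (1 - α - β) ^ (((d : ℝ) - 1) / 2) *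
      √(1 - α - β + d * α * β) * √(1 - α - β - (d - 2) * α * β))

/-- `E[Y²] / E[Y]² → τ` as `n → ∞` through the admissible values. -/
def SecondMomentLimit (d : ℕ) (α β : ℝ) : Prop :=
  Tendsto (fun n : ℕ => (𝔼 σ : Matchings d n, (numIndep α β σ : ℝ) ^ 2) /
      (𝔼 σ : Matchings d n, (numIndep α β σ : ℝ)) ^ 2)
    (admissibleAtTop α β) (𝓝 (tau d α β))

/-! ### Small subgraph conditioning

For each `n`, `Ω n` is a finite probability space with the uniform distribution; `l` is the filter
along which `n → ∞`. Sequences are indexed from `0`. -/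

section Conditioning

variable {Ω : ℕ → Type} [∀ n, Fintype (Ω n)] [∀ n, Nonempty (Ω n)]

/-- For each `k`, the variables `X 0, …, X (k-1)` are asymptotically independent Poisson variables,
and their means converge to the means `μ i` of the limits. -/
def AsympIndepPoisson (l : Filter ℕ) (X : ∀ n, ℕ → Ω n → ℕ) (μ : ℕ → ℝ) : Prop :=
  (∀ i, Tendsto (fun n => 𝔼 ω : Ω n, (X n i ω : ℝ)) l (𝓝 (μ i))) ∧
  ∀ (k : ℕ) (a : Fin k → ℕ),
    Tendsto
      (fun n => (Nat.card {ω : Ω n // ∀ i : Fin k, X n i ω = a i} : ℝ) / Fintype.card (Ω n)) l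
      (𝓝 (∏ i : Fin k, Real.exp (-μ i) * μ i ^ a i / (a i).factorial))

/-- For all `m₀, …, m_{k-1}`,
`E(Y [X 0]_{m₀} ⋯ [X (k-1)]_{m_{k-1}}) / E Y → ∏ i < k, (μ i (1 + δ i)) ^ m_i`. -/
def JointFactorialMoments (l : Filter ℕ) (X : ∀ n, ℕ → Ω n → ℕ) (Y : ∀ n, Ω n → ℝ)
    (μ δ : ℕ → ℝ) : Prop :=
  ∀ (k : ℕ) (m : Fin k → ℕ),
    Tendsto
      (fun n => (𝔼 ω : Ω n, Y n ω * ∏ i : Fin k, ((X n i ω).descFactorial (m i) : ℝ)) /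
        (𝔼 ω : Ω n, Y n ω)) l
      (𝓝 (∏ i : Fin k, (μ i * (1 + δ i)) ^ m i))

/-- The hypotheses of the small subgraph conditioning theorem. -/
structure SmallSubgraphConditions (l : Filter ℕ) (X : ∀ n, ℕ → Ω n → ℕ) (Y : ∀ n, Ω n → ℝ)
    (μ δ : ℕ → ℝ) : Prop where
  mean_pos : ∀ i, 0 < μ i
  delta_gt : ∀ i, -1 < δ i
  nonneg : ∀ n ω, 0 ≤ Y n ω
  expect_pos : ∀ᶠ n in l, 0 < 𝔼 ω : Ω n, Y n ω
  poisson : AsympIndepPoisson l X μ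
  moments : JointFactorialMoments l X Y μ δ
  summable : Summable fun i => μ i * δ i ^ 2
  second_moment : ∀ ε > 0, ∀ᶠ n in l,
    (𝔼 ω : Ω n, Y n ω ^ 2) / (𝔼 ω : Ω n, Y n ω) ^ 2 ≤ Real.exp (∑' i, μ i * δ i ^ 2) + ε

end Conditioning

/-- `X_{2(i+1)}`: the even cycle counts, indexed from `0`. -/
def evenCycles (d n i : ℕ) (σ : Matchings d n) : ℕ := numCycles (2 * (i + 1)) σ

/-- `Y`, as a real random variable. -/
def indepCount (d : ℕ) (α β : ℝ) (n : ℕ) (σ : Matchings d n) : ℝ := numIndep α β σ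

/-- `λ_{2(i+1)}`. -/
def evenLam (d i : ℕ) : ℝ := lam d (2 * (i + 1))

/-- `δ_{2(i+1)}`. -/
def evenDel (α β : ℝ) (i : ℕ) : ℝ := del α β (2 * (i + 1))

end BipartiteHardCore

end

/-!
Conditionally on `S ∪ T` being independent, a bounded set of `N` disjoint-in-each-matching edges is
present with probability asymptotic to `n⁻ᴺ` times a product of weights, each depending only on
which ends of the edge belong to `S` and `T`. This follows by exposing the edges one at a time: a
double count of the switchings of a matching, which exchange two vertices of the same type, compares
the outcomes with and without the next edge.

Cycles of length `2m` are counted by directed closed walks with a base point in `V₁`, `2m` to each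
cycle, so that a product of falling factorials of cycle counts counts families of such walks around
distinct cycles. Every family of edge-disjoint, vertex-disjoint walks has as many edges as vertices;
summing the weights over the vertices leaves a trace for every walk, with eigenvalues `1` and
`αβ / ((1-α)(1-β))`, and this gives the factor `λ (1 + δ)`. In a family of distinct cycles with a
repeated vertex there are more edges than vertices, so that the overlapping families contribute
`O(1/n)`. All estimates are uniform in `S` and `T`, and summing over them gives the joint moments
with `Y`; the case `α = β = 0`, `Y = 1`, and the method of moments give the Poisson limit.

Finally, `∑ λ δ²` is a combination of the logarithmic series of `((d-1) q)²` and `q²`, where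
`q = αβ / ((1-α)(1-β))`, and its exponential is exactly `τ`.
-/

noncomputable section

namespace BipartiteHardCore

/-! ### Traces of powers -/

section Trace

variable {ι R : Type*} [Fintype ι] [DecidableEq ι]

theorem matrix_pow_succ_apply_eq_sum_walks [CommSemiring R] (A : Matrix ι ι R) (m : ℕ) (x y : ι) :
    (A ^ (m + 1)) x y =
      ∑ f : Fin m → ι, ∏ t : Fin (m + 1),
        A ((Fin.cons x f : Fin (m + 1) → ι) t) ((Fin.snoc f y : Fin (m + 1) → ι) t) := by
  induction m generalizing x with
  | zero => simp [Fin.snoc]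
  | succ m ih =>
    rw [pow_succ', Matrix.mul_apply, ← (Fin.consEquiv fun _ => ι).sum_comp, Fintype.sum_prod_type]
    refine Finset.sum_congr rfl fun z _ => ?_
    rw [ih, Finset.mul_sum]
    refine Finset.sum_congr rfl fun f _ => ?_
    rw [Fin.prod_univ_succ (n := m + 1)]
    simp [Fin.consEquiv, ← Fin.cons_snoc_eq_snoc_cons]

theorem trace_pow_succ_eq_sum_closed_walks [CommSemiring R] (A : Matrix ι ι R) (m : ℕ) :
    (A ^ (m + 1)).trace = ∑ f : Fin (m + 1) → ι, ∏ t, A (f t) (f (t + 1)) := by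
  rw [Matrix.trace, ← (Fin.consEquiv fun _ => ι).sum_comp, Fintype.sum_prod_type]
  refine Finset.sum_congr rfl fun x _ => ?_
  rw [Matrix.diag_apply, matrix_pow_succ_apply_eq_sum_walks]
  refine Finset.sum_congr rfl fun f _ => Finset.prod_congr rfl fun t _ => ?_
  congr 1
  simp only [Fin.consEquiv, Equiv.coe_fn_mk]
  induction t using Fin.lastCases with
  | last => simp
  | cast t => simp

/-- The eigenvalues of `M` are `a` and `b`, with multiplicities `p` and `q`. -/
theorem trace_pow_of_sq_eq [CommRing R] {M : Matrix ι ι R} {a b p q : R}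
    (hsq : M ^ 2 = (a + b) • M - (a * b) • 1) (hcard : (Fintype.card ι : R) = p + q)
    (htrace : M.trace = p * a + q * b) (m : ℕ) :
    (M ^ m).trace = p * a ^ m + q * b ^ m := by
  induction m using Nat.twoStepInduction with
  | zero => simp [Matrix.trace_one, hcard]
  | one => simp [htrace]
  | more m h0 h1 =>
    rw [pow_add, hsq, mul_sub, Matrix.trace_sub, mul_smul_comm, mul_smul_comm, ← pow_succ,
      mul_one, Matrix.trace_smul, Matrix.trace_smul, h0, h1]
    simp only [smul_eq_mul]
    ring

end Trace

/-! ### Proper colourings of a cycle -/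

/-- The adjacency matrix of the complete graph on the colours. -/
def distinctMatrix (R : Type*) [Zero R] [One R] (d : ℕ) : Matrix (Fin d) (Fin d) R :=
  Matrix.of fun a b => if a ≠ b then 1 else 0

theorem properColorings_succ_eq_trace (R : Type*) [CommSemiring R] (d m : ℕ) :
    (properColorings d (m + 1) : R) = (distinctMatrix R d ^ (m + 1)).trace := by
  rw [trace_pow_succ_eq_sum_closed_walks, properColorings, Fintype.card_subtype,
    Finset.natCast_card_filter]
  refine Finset.sum_congr rfl fun c _ => ?_
  simp only [distinctMatrix, Matrix.of_apply, Finset.prod_ite_zero, Finset.prod_const_one,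
    Finset.mem_univ, forall_const, finRotate_apply]

theorem distinctMatrix_sq (R : Type*) [CommRing R] (d : ℕ) :
    distinctMatrix R d ^ 2 =
      ((d - 1 : R) + -1) • distinctMatrix R d - ((d - 1 : R) * -1) • 1 := by
  set U : Matrix (Fin d) (Fin d) R := Matrix.of fun _ _ => 1 with hU
  have hUU : U * U = (d : R) • U := by
    ext i j
    simp [hU, Matrix.mul_apply]
  have hsub : distinctMatrix R d = U - 1 := by
    ext i j
    by_cases h : i = j <;> simp [distinctMatrix, hU, h]
  rw [hsub, pow_two, sub_mul, mul_sub, hUU, mul_one, one_mul]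
  module

theorem properColorings_succ_eq (R : Type*) [CommRing R] (d m : ℕ) :
    (properColorings d (m + 1) : R) =
      ((d : R) - 1) ^ (m + 1) + ((d : R) - 1) * (-1) ^ (m + 1) := by
  rw [properColorings_succ_eq_trace,
    trace_pow_of_sq_eq (p := 1) (q := (d : R) - 1) (distinctMatrix_sq R d)]
  · ring
  · simp
  · simp [distinctMatrix, Matrix.trace]

/-! ### The transfer matrix -/

theorem transferMatrix_sq (α β : ℝ) :
    transferMatrix α β ^ 2 =
      !![β * (1 - β) / (1 - α - β) ^ 2, 1, 0, 0;
        β * (1 - β) / (1 - α - β) ^ 2, α * (1 - α) / (1 - α - β) ^ 2 + 1, 0, 0;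
        0, 0, α * (1 - α) / (1 - α - β) ^ 2, 1;
        0, 0, α * (1 - α) / (1 - α - β) ^ 2, β * (1 - β) / (1 - α - β) ^ 2 + 1] := by
  rw [pow_two]
  ext i j
  fin_cases i <;> fin_cases j <;> simp [transferMatrix, Matrix.mul_apply, Fin.sum_univ_four]

/-- Two steps of the transfer matrix act on each side of the bipartition with eigenvalues `1` and
`αβ / ((1-α)(1-β))`. -/
theorem stepWeight_pow_mul_trace_transferMatrix_pow {α β : ℝ} (hα : α < 1) (hβ : β < 1)
    (hαβ : 1 - α - β ≠ 0) (m : ℕ) :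
    stepWeight α β ^ (2 * m) * (transferMatrix α β ^ (2 * m)).trace =
      2 * (1 + (α * β / ((1 - α) * (1 - β))) ^ m) := by
  have h1 : 1 - α ≠ 0 := (sub_pos.2 hα).ne'
  have h2 : 1 - β ≠ 0 := (sub_pos.2 hβ).ne'
  have hweight : stepWeight α β ^ 2 = (1 - α - β) ^ 2 / ((1 - α) * (1 - β)) := by
    rw [stepWeight, div_pow,
      Real.sq_sqrt (mul_nonneg (sub_nonneg.2 hα.le) (sub_nonneg.2 hβ.le))]
  have htrace := trace_pow_of_sq_eq (M := (stepWeight α β ^ 2) • transferMatrix α β ^ 2)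
    (a := 1) (b := α * β / ((1 - α) * (1 - β))) (p := 2) (q := 2)
    (by
      rw [transferMatrix_sq, hweight, pow_two]
      ext i j
      fin_cases i <;> fin_cases j <;>
        simp [Matrix.mul_apply, Fin.sum_univ_four] <;> field_simp <;> ring)
    (by norm_num)
    (by
      rw [transferMatrix_sq, hweight]
      simp only [Matrix.trace, Matrix.diag, Matrix.smul_apply, Fin.sum_univ_four, smul_eq_mul,
        Matrix.of_apply, Matrix.cons_val', Matrix.cons_val_zero, Matrix.cons_val_fin_one,
        Matrix.cons_val_one, Matrix.cons_val, mul_one]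
      field_simp
      ring) m
  rw [smul_pow, Matrix.trace_smul, ← pow_mul, ← pow_mul, smul_eq_mul] at htrace
  rw [htrace]
  ring

theorem one_add_del_eq_trace {α β : ℝ} (hα : α < 1) (hβ : β < 1) (hαβ : 1 - α - β ≠ 0) {ℓ : ℕ}
    (hℓ : Even ℓ) :
    1 + del α β ℓ = stepWeight α β ^ ℓ * (transferMatrix α β ^ ℓ).trace / 2 := by
  obtain ⟨m, rfl⟩ := hℓ.two_dvd
  rw [stepWeight_pow_mul_trace_transferMatrix_pow hα hβ hαβ, del,
    Nat.mul_div_cancel_left _ two_pos]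
  ring

/-! ### The method of moments for Poisson limits -/

theorem tendsto_of_forall_dist_le {ι κ E : Type*} [PseudoMetricSpace E] {l : Filter ι}
    {l' : Filter κ} [l'.NeBot] {u : ι → E} {P : κ → ι → E} {R : κ → ι → ℝ} {S : κ → E} {ρ : κ → ℝ}
    {L : E} (hdist : ∀ r n, dist (u n) (P r n) ≤ R r n) (hP : ∀ r, Tendsto (P r) l (𝓝 (S r)))
    (hR : ∀ r, Tendsto (R r) l (𝓝 (ρ r))) (hS : Tendsto S l' (𝓝 L)) (hρ : Tendsto ρ l' (𝓝 0)) :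
    Tendsto u l (𝓝 L) := by
  rw [Metric.tendsto_nhds]
  intro ε hε
  obtain ⟨r, hSr, hρr⟩ := ((Metric.tendsto_nhds.1 hS (ε / 3) (by positivity)).and
    (hρ.eventually_lt_const (by positivity : 0 < ε / 3))).exists
  filter_upwards [Metric.tendsto_nhds.1 (hP r) (ε / 3) (by positivity),
    (hR r).eventually_lt_const hρr] with n hPn hRn
  calc dist (u n) L ≤ dist (u n) (P r n) + dist (P r n) (S r) + dist (S r) L :=
        dist_triangle4 _ _ _ _
    _ < ε / 3 + ε / 3 + ε / 3 := by linarith [hdist r n]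
    _ = ε := by ring

theorem abs_alternating_sum_choose_sub_le (N r : ℕ) :
    |(if N = 0 then (1 : ℝ) else 0) - ∑ j ∈ Finset.range (r + 1), (-1 : ℝ) ^ j * N.choose j| ≤
      N.choose (r + 1) := by
  rcases N with _ | N
  · simp [Finset.sum_range_succ']
  · have h : ∑ j ∈ Finset.range (r + 1), (-1 : ℝ) ^ j * ((N + 1).choose j : ℝ) =
        (-1) ^ r * (N.choose r : ℝ) := by
      exact_mod_cast @Int.alternating_sum_range_choose_eq_choose N r
    rw [h, if_neg N.succ_ne_zero, zero_sub, abs_neg, abs_mul, abs_pow, abs_neg, abs_one, one_pow,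
      one_mul, Nat.abs_cast, Nat.choose_succ_succ]
    exact_mod_cast Nat.le_add_right _ _

theorem choose_mul_choose_sub_eq (x a j : ℕ) :
    (x.choose a : ℝ) * (x - a).choose j =
      (x.descFactorial (a + j) : ℝ) / (a.factorial * j.factorial) := by
  rw [eq_div_iff (by positivity)]
  have h : x.descFactorial (a + j) = x.descFactorial a * (x - a).descFactorial j := by
    rw [mul_comm, ← Nat.descFactorial_mul_descFactorial (Nat.le_add_right a j),
      Nat.add_sub_cancel_left]
  rw [h, Nat.descFactorial_eq_factorial_mul_choose x a,
    Nat.descFactorial_eq_factorial_mul_choose (x - a) j]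
  push_cast
  ring

/-- The partial sums of the inclusion-exclusion formula for the event `x = a`. -/
def bonferroniSum (u : ℕ → ℝ) (a r : ℕ) : ℝ :=
  ∑ j ∈ Finset.range (r + 1), (-1) ^ j * (u (a + j) / (a.factorial * j.factorial))

theorem abs_indicator_sub_bonferroniSum_le (x a r : ℕ) :
    |(if x = a then (1 : ℝ) else 0) - bonferroniSum (fun m => x.descFactorial m) a r| ≤
      (x.descFactorial (a + (r + 1)) : ℝ) / (a.factorial * (r + 1).factorial) := by
  have hsum : bonferroniSum (fun m => x.descFactorial m) a r =
      x.choose a * ∑ j ∈ Finset.range (r + 1), (-1 : ℝ) ^ j * (x - a).choose j := by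
    rw [bonferroniSum, Finset.mul_sum]
    refine Finset.sum_congr rfl fun j _ => ?_
    rw [← choose_mul_choose_sub_eq]
    ring
  have hind : (if x = a then (1 : ℝ) else 0) = x.choose a * (if x - a = 0 then 1 else 0) := by
    rcases lt_trichotomy x a with h | h | h
    · simp [h.ne, Nat.choose_eq_zero_of_lt h]
    · simp [h]
    · rw [if_neg h.ne', if_neg (Nat.sub_ne_zero_of_lt h), mul_zero]
  rw [hsum, hind, ← mul_sub, abs_mul, Nat.abs_cast, ← choose_mul_choose_sub_eq]
  exact mul_le_mul_of_nonneg_left (abs_alternating_sum_choose_sub_le _ _) (Nat.cast_nonneg _)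

theorem tendsto_bonferroniSum_pow (c μ : ℝ) (a : ℕ) :
    Tendsto (bonferroniSum (fun m => c * μ ^ m) a) atTop
      (𝓝 (c * (Real.exp (-μ) * μ ^ a / a.factorial))) := by
  have hexp : HasSum (fun j : ℕ => (-μ) ^ j / (j.factorial : ℝ)) (Real.exp (-μ)) := by
    rw [Real.exp_eq_exp_ℝ]
    exact NormedSpace.expSeries_div_hasSum_exp (-μ)
  have hlim := (hexp.mul_left (c * μ ^ a / a.factorial)).tendsto_sum_nat.comp
    (tendsto_add_atTop_nat 1)
  rw [show c * μ ^ a / a.factorial * Real.exp (-μ) =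
    c * (Real.exp (-μ) * μ ^ a / a.factorial) by ring] at hlim
  refine hlim.congr fun r => Finset.sum_congr rfl fun j _ => ?_
  rw [neg_pow]
  simp only [pow_add]
  field_simp

theorem tendsto_pow_add_div_factorial (c μ : ℝ) (a : ℕ) :
    Tendsto (fun r : ℕ => c * μ ^ (a + (r + 1)) / (a.factorial * (r + 1).factorial)) atTop
      (𝓝 0) := by
  have hlim := ((FloorSemiring.tendsto_pow_div_factorial_atTop μ).comp
    (tendsto_add_atTop_nat 1)).const_mul (c * μ ^ a / a.factorial)
  rw [mul_zero] at hlim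
  refine hlim.congr fun r => ?_
  simp only [Function.comp]
  rw [pow_add μ a]
  field_simp

section MethodOfMoments

variable {ι : Type*} {Ω : ι → Type*} [∀ n, Fintype (Ω n)] {l : Filter ι}

theorem tendsto_weighted_indicator {X : ∀ n, Ω n → ℕ} {Y : ∀ n, Ω n → ℝ} (hY : ∀ n ω, 0 ≤ Y n ω)
    {c μ : ℝ}
    (h : ∀ m : ℕ, Tendsto (fun n => ∑ ω, Y n ω * ((X n ω).descFactorial m : ℝ)) l
      (𝓝 (c * μ ^ m))) (a : ℕ) :
    Tendsto (fun n => ∑ ω, Y n ω * (if X n ω = a then 1 else 0)) l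
      (𝓝 (c * (Real.exp (-μ) * μ ^ a / a.factorial))) := by
  set M : ι → ℕ → ℝ := fun n m => ∑ ω, Y n ω * ((X n ω).descFactorial m : ℝ)
  have hmoments : ∀ n r, bonferroniSum (M n) a r =
      ∑ ω, Y n ω * bonferroniSum (fun m => (X n ω).descFactorial m) a r := by
    intro n r
    simp only [M, bonferroniSum, Finset.sum_div, Finset.mul_sum]
    rw [Finset.sum_comm]
    exact Finset.sum_congr rfl fun ω _ => Finset.sum_congr rfl fun j _ => by ring
  refine tendsto_of_forall_dist_le (P := fun r n => bonferroniSum (M n) a r)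
    (R := fun r n => M n (a + (r + 1)) / (a.factorial * (r + 1).factorial)) (fun r n => ?_)
    (fun r => tendsto_finsetSum _ fun j _ => ((h (a + j)).div_const _).const_mul _)
    (fun r => (h _).div_const _) (tendsto_bonferroniSum_pow c μ a)
    (tendsto_pow_add_div_factorial c μ a)
  rw [hmoments, Real.dist_eq, ← Finset.sum_sub_distrib, Finset.sum_div]
  refine (Finset.abs_sum_le_sum_abs _ _).trans (Finset.sum_le_sum fun ω _ => ?_)
  rw [← mul_sub, abs_mul, abs_of_nonneg (hY n ω), mul_div_assoc]
  exact mul_le_mul_of_nonneg_left (abs_indicator_sub_bonferroniSum_le _ _ _) (hY n ω)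

theorem tendsto_weighted_joint_indicator {k : ℕ} {X : ∀ n, Fin k → Ω n → ℕ}
    {Y : ∀ n, Ω n → ℝ} (hY : ∀ n ω, 0 ≤ Y n ω) {c : ℝ} {μ : Fin k → ℝ}
    (h : ∀ m : Fin k → ℕ, Tendsto
      (fun n => ∑ ω, Y n ω * ∏ i, ((X n i ω).descFactorial (m i) : ℝ)) l
      (𝓝 (c * ∏ i, μ i ^ m i))) (a : Fin k → ℕ) :
    Tendsto (fun n => ∑ ω, Y n ω * ∏ i, (if X n i ω = a i then 1 else 0)) l
      (𝓝 (c * ∏ i, (Real.exp (-μ i) * μ i ^ a i / (a i).factorial))) := by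
  -- The factors already replaced by indicators are absorbed into the weight.
  induction k generalizing Y c with
  | zero => simpa using h a
  | succ k ih =>
    simp only [Fin.prod_univ_succ, ← mul_assoc]
    refine ih (X := fun n i => X n i.succ) (μ := fun i => μ i.succ)
      (Y := fun n ω => Y n ω * (if X n 0 ω = a 0 then 1 else 0))
      (fun n ω => mul_nonneg (hY n ω) (by split_ifs <;> norm_num)) (fun m => ?_)
      (fun i => a i.succ)
    have hhead := tendsto_weighted_indicator (l := l) (X := fun n => X n 0)
      (Y := fun n ω => Y n ω * ∏ i : Fin k, ((X n i.succ ω).descFactorial (m i) : ℝ))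
      (fun n ω => mul_nonneg (hY n ω) (Finset.prod_nonneg fun _ _ => Nat.cast_nonneg _))
      (c := c * ∏ i : Fin k, μ i.succ ^ m i) (μ := μ 0)
      (fun m₀ => by
        simpa [Fin.prod_univ_succ, mul_assoc, mul_comm, mul_left_comm] using h (Fin.cons m₀ m))
      (a 0)
    simpa only [mul_right_comm] using hhead

end MethodOfMoments

theorem asympIndepPoisson_of_tendsto_factorialMoments {Ω : ℕ → Type} [∀ n, Fintype (Ω n)]
    [∀ n, Nonempty (Ω n)] {l : Filter ℕ} {X : ∀ n, ℕ → Ω n → ℕ} {μ : ℕ → ℝ}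
    (h : ∀ (k : ℕ) (m : Fin k → ℕ), Tendsto
      (fun n => 𝔼 ω : Ω n, ∏ i : Fin k, ((X n i ω).descFactorial (m i) : ℝ)) l
      (𝓝 (∏ i : Fin k, μ i ^ m i))) :
    AsympIndepPoisson l X μ := by
  refine ⟨fun i => ?_, fun k a => ?_⟩
  · have hmean := h (i + 1) (Pi.single (Fin.last i) 1)
    simpa only [Fin.prod_univ_castSucc, Pi.single_eq_same, Nat.descFactorial_one, pow_one, ne_eq,
      Fin.castSucc_ne_last, not_false_eq_true, Pi.single_eq_of_ne, Nat.descFactorial_zero, pow_zero,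
      Nat.cast_one, Finset.prod_const_one, one_mul, Fin.val_last] using hmean
  · have hprob := tendsto_weighted_joint_indicator (l := l) (X := fun n (i : Fin k) => X n i)
      (Y := fun n _ => ((Fintype.card (Ω n) : ℝ))⁻¹) (fun n _ => by positivity) (c := 1)
      (μ := fun i => μ i)
      (fun m => by
        simpa only [one_mul, Fintype.expect_eq_sum_div_card, Finset.sum_div, inv_mul_eq_div]
          using h k m) a
    rw [one_mul] at hprob
    refine hprob.congr fun n => ?_
    rw [← Finset.mul_sum, inv_mul_eq_div]
    simp only [Finset.prod_ite_zero, Finset.prod_const_one, Finset.mem_univ, forall_const]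
    rw [Finset.sum_boole, Nat.card_eq_fintype_card, Fintype.card_subtype]

/-! ### Tours -/

section PotentialEdge

variable {d n : ℕ}

/-- An edge that may or may not be present: `(k, u, w)` joins `u ∈ V₁` to `w ∈ V₂` in the `k`-th
matching. -/
abbrev PotentialEdge (d n : ℕ) : Type := Fin d × Fin n × Fin n

/-- The edge of the multigraph in the same matching and with the same end in `V₁`; it is the
potential edge itself when that is present. -/
def toEdge (e : PotentialEdge d n) : Edge d n := (e.1, e.2.1)

/-- All edges of `F` are present. -/
def Contains (σ : Matchings d n) (F : Finset (PotentialEdge d n)) : Prop :=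
  ∀ e ∈ F, σ e.1 e.2.1 = e.2.2

end PotentialEdge

/-- A family of directed closed walks in the complete multigraph, each with a base point in `V₁`.
With a permutation `s` of `J` describing the successor, the walk goes from `left t ∈ V₁` along the
matching `fwd t` to `right t ∈ V₂` and along the matching `back t` to `left (s t)`. -/
@[ext]
structure Tour (d n : ℕ) (J : Type*) where
  left : J → Fin n
  right : J → Fin n
  fwd : J → Fin d
  back : J → Fin d

/-- The successor on the positions of a walk: position `(t, false)` is in `V₁` and position
`(t, true)` in `V₂`. -/
def stepPerm {J : Type*} (s : Equiv.Perm J) : Equiv.Perm (J × Bool) where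
  toFun
    | (t, false) => (t, true)
    | (t, true) => (s t, false)
  invFun
    | (t, false) => (s.symm t, true)
    | (t, true) => (t, false)
  left_inv := by rintro ⟨t, _ | _⟩ <;> simp
  right_inv := by rintro ⟨t, _ | _⟩ <;> simp

section stepPerm

variable {J : Type*} (s : Equiv.Perm J) (t : J)

@[simp] theorem stepPerm_false : stepPerm s (t, false) = (t, true) := rfl

@[simp] theorem stepPerm_true : stepPerm s (t, true) = (s t, false) := rfl

end stepPerm

namespace Tour

variable {d n : ℕ} {J : Type*}

/-- A tour as a quadruple of functions. -/
def equivProd (d n : ℕ) (J : Type*) :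
    Tour d n J ≃ ((J → Fin n) × (J → Fin n)) × (J → Fin d) × (J → Fin d) where
  toFun p := ((p.left, p.right), p.fwd, p.back)
  invFun q := ⟨q.1.1, q.1.2, q.2.1, q.2.2⟩

instance [Fintype J] [DecidableEq J] : Fintype (Tour d n J) :=
  Fintype.ofEquiv _ (equivProd d n J).symm

instance : DecidableEq (Tour d n J) := Classical.decEq _

/-- The vertex at a position. -/
def vertex (p : Tour d n J) : J × Bool → Fin n ⊕ Fin n
  | (t, false) => Sum.inl (p.left t)
  | (t, true) => Sum.inr (p.right t)

/-- The edge from a position to the next. -/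
def edge (s : Equiv.Perm J) (p : Tour d n J) : J × Bool → PotentialEdge d n
  | (t, false) => (p.fwd t, p.left t, p.right t)
  | (t, true) => (p.back t, p.left (s t), p.right t)

@[simp] theorem vertex_false (p : Tour d n J) (t : J) : p.vertex (t, false) = .inl (p.left t) :=
  rfl

@[simp] theorem vertex_true (p : Tour d n J) (t : J) : p.vertex (t, true) = .inr (p.right t) := rfl

@[simp] theorem edge_false (s : Equiv.Perm J) (p : Tour d n J) (t : J) :
    p.edge s (t, false) = (p.fwd t, p.left t, p.right t) := rfl

@[simp] theorem edge_true (s : Equiv.Perm J) (p : Tour d n J) (t : J) :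
    p.edge s (t, true) = (p.back t, p.left (s t), p.right t) := rfl

/-- Consecutive edges of the tour are in different matchings. -/
def Proper (s : Equiv.Perm J) (p : Tour d n J) : Prop :=
  ∀ t, p.fwd t ≠ p.back t ∧ p.back t ≠ p.fwd (s t)

theorem vertex_injective_iff {p : Tour d n J} :
    Function.Injective p.vertex ↔ Function.Injective p.left ∧ Function.Injective p.right := by
  constructor
  · exact fun h => ⟨fun t t' ht => congrArg Prod.fst (@h (t, false) (t', false) (by simp [ht])),
      fun t t' ht => congrArg Prod.fst (@h (t, true) (t', true) (by simp [ht]))⟩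
  · rintro ⟨hl, hr⟩ ⟨t, _ | _⟩ ⟨t', _ | _⟩ h
    · rw [hl (Sum.inl.inj h)]
    · exact absurd h Sum.inl_ne_inr
    · exact absurd h Sum.inr_ne_inl
    · rw [hr (Sum.inr.inj h)]

theorem Proper.toEdge_edge_injective {s : Equiv.Perm J} {p : Tour d n J} (hp : p.Proper s)
    (hl : Function.Injective p.left) : Function.Injective fun x => toEdge (p.edge s x) := by
  rintro ⟨t, _ | _⟩ ⟨t', _ | _⟩ h <;> obtain ⟨hk, hu⟩ := Prod.mk.inj h
  · rw [hl hu]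
  · obtain rfl := hl hu
    exact absurd hk.symm (hp t').2
  · obtain rfl := hl hu
    exact absurd hk (hp t).2
  · rw [s.injective (hl hu)]

variable [Fintype J]

/-- The set of edges of a tour. -/
def edges (s : Equiv.Perm J) (p : Tour d n J) : Finset (PotentialEdge d n) :=
  Finset.univ.image (p.edge s)

/-- The set of edges of the multigraph traversed by a tour that is present in it. -/
def edgeSet (s : Equiv.Perm J) (p : Tour d n J) : Finset (Edge d n) :=
  (p.edges s).image toEdge

theorem edge_mem_edges (s : Equiv.Perm J) (p : Tour d n J) (x : J × Bool) :
    p.edge s x ∈ p.edges s :=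
  Finset.mem_image_of_mem _ (Finset.mem_univ x)

theorem edgeSet_eq_image (s : Equiv.Perm J) (p : Tour d n J) :
    p.edgeSet s = Finset.univ.image fun x => toEdge (p.edge s x) :=
  Finset.image_image

theorem mem_edgeSet {s : Equiv.Perm J} {p : Tour d n J} {e : Edge d n} :
    e ∈ p.edgeSet s ↔ ∃ x, toEdge (p.edge s x) = e := by
  simp [edgeSet_eq_image]

theorem Proper.card_edgeSet {s : Equiv.Perm J} {p : Tour d n J} (hp : p.Proper s)
    (hl : Function.Injective p.left) : (p.edgeSet s).card = 2 * Fintype.card J := by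
  rw [edgeSet_eq_image, Finset.card_image_of_injective _ (hp.toEdge_edge_injective hl),
    Finset.card_univ, Fintype.card_prod, Fintype.card_bool, mul_comm]

/-- The tour traverses a disjoint union of cycles of the multigraph. -/
structure IsTour (σ : Matchings d n) (s : Equiv.Perm J) (p : Tour d n J) : Prop where
  left_inj : Function.Injective p.left
  right_inj : Function.Injective p.right
  proper : p.Proper s
  present : Contains σ (p.edges s)

theorem contains_edges_iff {σ : Matchings d n} {s : Equiv.Perm J} {p : Tour d n J} :
    Contains σ (p.edges s) ↔
      (∀ t, σ (p.fwd t) (p.left t) = p.right t) ∧ ∀ t, σ (p.back t) (p.left (s t)) = p.right t := by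
  simp only [Contains, edges, Finset.forall_mem_image, Finset.mem_univ, true_imp_iff, Prod.forall,
    Bool.forall_bool, edge_false, edge_true, forall_and]

theorem ends_toEdge_edge {σ : Matchings d n} {s : Equiv.Perm J} {p : Tour d n J}
    (h : Contains σ (p.edges s)) (x : J × Bool) :
    ends σ (toEdge (p.edge s x)) = s(p.vertex x, p.vertex (stepPerm s x)) := by
  obtain ⟨hfwd, hback⟩ := contains_edges_iff.1 h
  rcases x with ⟨t, _ | _⟩
  · simp [ends, toEdge, hfwd]
  · simp [ends, toEdge, hback]

theorem isTour_iff_injective {σ : Matchings d n} {s : Equiv.Perm J} {p : Tour d n J} :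
    p.IsTour σ s ↔ Function.Injective p.vertex ∧
      (Function.Injective fun x => toEdge (p.edge s x)) ∧ Contains σ (p.edges s) := by
  constructor
  · exact fun hp => ⟨vertex_injective_iff.2 ⟨hp.left_inj, hp.right_inj⟩,
      hp.proper.toEdge_edge_injective hp.left_inj, hp.present⟩
  · rintro ⟨hv, he, hσ⟩
    obtain ⟨hfwd, hback⟩ := contains_edges_iff.1 hσ
    obtain ⟨hl, hr⟩ := vertex_injective_iff.1 hv
    refine ⟨hl, hr, fun t => ⟨fun h => ?_, fun h => ?_⟩, hσ⟩
    · -- Two edges of the same matching that share their end in `V₂` are equal.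
      have hleft : p.left t = p.left (s t) :=
        (σ (p.fwd t)).injective ((hfwd t).trans (by rw [h, hback]))
      have := @he (t, false) (t, true) (by simp [toEdge, h, ← hleft])
      simp at this
    · have := @he (t, true) (s t, false) (by simp [toEdge, h])
      simp at this

end Tour

/-! ### Cycles are traversed by tours -/

section Walk

variable {d n : ℕ} {σ : Matchings d n}

theorem ends_eq_mk_inl {e : Edge d n} {u : Fin n} {x : Fin n ⊕ Fin n}
    (h : ends σ e = s(Sum.inl u, x)) : e.2 = u ∧ x = Sum.inr (σ e.1 u) := by
  rw [ends, Sym2.eq_iff] at h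
  rcases h with ⟨hu, hx⟩ | ⟨-, hu⟩
  · obtain rfl := Sum.inl.inj hu
    exact ⟨rfl, hx.symm⟩
  · exact absurd hu Sum.inr_ne_inl

theorem ends_eq_mk_inr {e : Edge d n} {w : Fin n} {x : Fin n ⊕ Fin n}
    (h : ends σ e = s(Sum.inr w, x)) : x = Sum.inl e.2 ∧ σ e.1 e.2 = w := by
  rw [ends, Sym2.eq_iff] at h
  rcases h with ⟨hw, -⟩ | ⟨hx, hw⟩
  · exact absurd hw Sum.inl_ne_inr
  · exact ⟨hx.symm, Sum.inr.inj hw⟩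

variable {J : Type*} [Fintype J] {s : Equiv.Perm J} {v : J × Bool → Fin n ⊕ Fin n}
  {e : J × Bool → Edge d n}

theorem exists_tour_of_walk (hve : ∀ x, ends σ (e x) = s(v x, v (stepPerm s x)))
    (hleft : ∀ t, ∃ u, v (t, false) = Sum.inl u) :
    ∃ p : Tour d n J, p.vertex = v ∧ (fun x => toEdge (p.edge s x)) = e ∧
      Contains σ (p.edges s) := by
  choose u hu using hleft
  have hfwd t : (e (t, false)).2 = u t ∧ v (t, true) = Sum.inr (σ (e (t, false)).1 (u t)) :=
    ends_eq_mk_inl (by rw [hve, hu, stepPerm_false])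
  have hback t : v (s t, false) = Sum.inl (e (t, true)).2 ∧
      σ (e (t, true)).1 (e (t, true)).2 = σ (e (t, false)).1 (u t) :=
    ends_eq_mk_inr (by rw [hve, (hfwd t).2, stepPerm_true])
  have hnext t : (e (t, true)).2 = u (s t) := Sum.inl.inj ((hback t).1.symm.trans (hu (s t)))
  refine ⟨⟨u, fun t => σ (e (t, false)).1 (u t), fun t => (e (t, false)).1,
    fun t => (e (t, true)).1⟩, ?_, ?_, ?_⟩
  · ext ⟨t, _ | _⟩ : 1
    exacts [(hu t).symm, (hfwd t).2.symm]
  · ext ⟨t, _ | _⟩ : 1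
    exacts [Prod.ext rfl (hfwd t).1.symm, Prod.ext rfl (hnext t).symm]
  · exact Tour.contains_edges_iff.2 ⟨fun t => rfl, fun t => by
      simpa only [hnext] using (hback t).2⟩

theorem exists_isTour_of_walk (hv : Function.Injective v) (he : Function.Injective e)
    (hve : ∀ x, ends σ (e x) = s(v x, v (stepPerm s x)))
    (hleft : ∀ t, ∃ u, v (t, false) = Sum.inl u) :
    ∃ p : Tour d n J, p.IsTour σ s ∧ p.edgeSet s = Finset.univ.image e := by
  obtain ⟨p, rfl, rfl, hσ⟩ := exists_tour_of_walk hve hleft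
  exact ⟨p, Tour.isTour_iff_injective.2 ⟨hv, he, hσ⟩, p.edgeSet_eq_image s⟩

end Walk

/-- The successor on the base points of a cycle of length `2 (m + 1)`. -/
abbrev succPerm (m : ℕ) : Equiv.Perm (Fin (m + 1)) := Equiv.addRight 1

theorem succPerm_apply {m : ℕ} (t : Fin (m + 1)) : succPerm m t = t + 1 := rfl

/-- The positions of a cycle of length `2 (m + 1)` in cyclic order, alternately in `V₁` and `V₂`. -/
def interleave (m : ℕ) : Fin (m + 1) × Bool ≃ Fin (2 * (m + 1)) :=
  ((Equiv.refl _).prodCongr finTwoEquiv.symm).trans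
    (finProdFinEquiv.trans (finCongr (mul_comm _ _)))

theorem val_interleave_false (m : ℕ) (t : Fin (m + 1)) :
    (interleave m (t, false) : ℕ) = 2 * t := by
  simp [interleave, finTwoEquiv]

theorem val_interleave_true (m : ℕ) (t : Fin (m + 1)) :
    (interleave m (t, true) : ℕ) = 2 * t + 1 := by
  simp [interleave, finTwoEquiv, add_comm]

theorem val_finRotate {ℓ : ℕ} (i : Fin ℓ) : (finRotate ℓ i : ℕ) = (i + 1) % ℓ := by
  cases ℓ with
  | zero => exact i.elim0
  | succ ℓ => rw [finRotate_apply, Fin.val_add, Fin.val_one', Nat.add_mod_mod]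

theorem finRotate_interleave (m : ℕ) (x : Fin (m + 1) × Bool) :
    finRotate _ (interleave m x) = interleave m (stepPerm (succPerm m) x) := by
  ext
  rw [val_finRotate]
  rcases x with ⟨t, _ | _⟩
  · rw [stepPerm_false, val_interleave_false, val_interleave_true]
    exact Nat.mod_eq_of_lt (by omega)
  · rw [stepPerm_true, val_interleave_false, val_interleave_true, succPerm_apply,
      Fin.val_add_one]
    split_ifs with h
    · simp [h, mul_add]
    · have : (t : ℕ) ≠ m := fun h' => h (Fin.ext h')
      rw [Nat.mod_eq_of_lt (by omega)]
      ring

section IsCycle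

variable {d n m : ℕ} {σ : Matchings d n} {C : Finset (Edge d n)}

theorem isCycle_iff_exists_walk :
    IsCycle σ (2 * (m + 1)) C ↔
      ∃ (v : Fin (m + 1) × Bool → Fin n ⊕ Fin n) (e : Fin (m + 1) × Bool → Edge d n),
        Function.Injective v ∧ Function.Injective e ∧
        (∀ x, ends σ (e x) = s(v x, v (stepPerm (succPerm m) x))) ∧ C = Finset.univ.image e := by
  constructor
  · rintro ⟨v, e, hv, he, hve, rfl⟩
    refine ⟨v ∘ interleave m, e ∘ interleave m, hv.comp (interleave m).injective,
      he.comp (interleave m).injective, fun x => ?_, ?_⟩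
    · simp only [Function.comp, hve, finRotate_interleave]
    · rw [← Finset.image_image, Finset.image_univ_equiv]
  · rintro ⟨v, e, hv, he, hve, rfl⟩
    refine ⟨v ∘ (interleave m).symm, e ∘ (interleave m).symm,
      hv.comp (interleave m).symm.injective, he.comp (interleave m).symm.injective, fun i => ?_, ?_⟩
    · obtain ⟨x, rfl⟩ := (interleave m).surjective i
      simp only [Function.comp, finRotate_interleave, Equiv.symm_apply_apply, hve]
    · rw [← Finset.image_image, Finset.image_univ_equiv]

theorem exists_inl_of_walk {v : Fin (m + 1) × Bool → Fin n ⊕ Fin n}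
    {e : Fin (m + 1) × Bool → Edge d n}
    (hve : ∀ x, ends σ (e x) = s(v x, v (stepPerm (succPerm m) x)))
    (h0 : ∃ u, v (0, false) = Sum.inl u) (t : Fin (m + 1)) : ∃ u, v (t, false) = Sum.inl u := by
  induction t using Fin.induction with
  | zero => exact h0
  | succ t ih =>
    obtain ⟨u, hu⟩ := ih
    have hright := (ends_eq_mk_inl ((hve (t.castSucc, false)).trans (by rw [hu]))).2
    rw [stepPerm_false] at hright
    have hleft := (ends_eq_mk_inr ((hve (t.castSucc, true)).trans (by rw [hright]))).1
    rw [stepPerm_true, succPerm_apply, Fin.coeSucc_eq_succ] at hleft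
    exact ⟨_, hleft⟩

theorem isCycle_iff_exists_isTour :
    IsCycle σ (2 * (m + 1)) C ↔
      ∃ p : Tour d n (Fin (m + 1)), p.IsTour σ (succPerm m) ∧ p.edgeSet (succPerm m) = C := by
  rw [isCycle_iff_exists_walk]
  constructor
  · rintro ⟨v, e, hv, he, hve, rfl⟩
    rcases h0 : v (0, false) with u | w
    · exact exists_isTour_of_walk hv he hve (exists_inl_of_walk hve ⟨u, h0⟩)
    · set τ := stepPerm (succPerm m)
      have hright : ∃ u, v (τ (0, false)) = Sum.inl u :=
        ⟨_, (ends_eq_mk_inr ((hve (0, false)).trans (by rw [h0]))).1⟩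
      have hshift : ∀ x, ends σ ((e ∘ τ) x) = s((v ∘ τ) x, (v ∘ τ) (τ x)) := fun x => hve (τ x)
      obtain ⟨p, hp, hpe⟩ := exists_isTour_of_walk (hv.comp τ.injective) (he.comp τ.injective)
        hshift (exists_inl_of_walk hshift hright)
      exact ⟨p, hp, by rw [hpe, ← Finset.image_image, Finset.image_univ_equiv]⟩
  · rintro ⟨p, hp, rfl⟩
    obtain ⟨hv, he, hσ⟩ := Tour.isTour_iff_injective.1 hp
    exact ⟨p.vertex, _, hv, he, Tour.ends_toEdge_edge hσ, p.edgeSet_eq_image _⟩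

end IsCycle

/-! ### The number of tours of a cycle -/

namespace Tour

section Determined

variable {d n : ℕ} {σ : Matchings d n} {J : Type*} [Fintype J] {s : Equiv.Perm J}
  {p q : Tour d n J}

theorem IsTour.eq_of_mem_of_right (hp : p.IsTour σ s) {e : Edge d n} (he : e ∈ p.edgeSet s) {t : J}
    (h : σ e.1 e.2 = p.right t) : e = (p.fwd t, p.left t) ∨ e = (p.back t, p.left (s t)) := by
  obtain ⟨⟨t', b⟩, rfl⟩ := mem_edgeSet.1 he
  have hright := (hp.present _ (p.edge_mem_edges s (t', b))).symm.trans h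
  cases b <;> (obtain rfl := hp.right_inj hright; simp [toEdge])

theorem IsTour.eq_of_mem_of_left (hp : p.IsTour σ s) {e : Edge d n} (he : e ∈ p.edgeSet s) {t : J}
    (h : e.2 = p.left (s t)) : e = (p.fwd (s t), p.left (s t)) ∨ e = (p.back t, p.left (s t)) := by
  obtain ⟨⟨t', _ | _⟩, rfl⟩ := mem_edgeSet.1 he
  · obtain rfl := hp.left_inj h
    exact Or.inl rfl
  · obtain rfl := s.injective (hp.left_inj h)
    exact Or.inr rfl

theorem IsTour.agree_succ (hp : p.IsTour σ s) (hq : q.IsTour σ s)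
    (he : q.edgeSet s = p.edgeSet s) {t : J}
    (ht : (q.fwd t, q.left t) = (p.fwd t, p.left t)) :
    q.right t = p.right t ∧ (q.back t, q.left (s t)) = (p.back t, p.left (s t)) ∧
      (q.fwd (s t), q.left (s t)) = (p.fwd (s t), p.left (s t)) := by
  obtain ⟨hf, hl⟩ := Prod.mk.inj ht
  have hright : q.right t = p.right t := by
    rw [← (contains_edges_iff.1 hp.present).1, ← (contains_edges_iff.1 hq.present).1, hf, hl]
  have hback : (q.back t, q.left (s t)) = (p.back t, p.left (s t)) := by
    refine (hp.eq_of_mem_of_right (t := t) (he ▸ mem_edgeSet.2 ⟨(t, true), rfl⟩) ?_).resolve_left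
      fun h => (hq.proper t).1 (hf.trans (congrArg Prod.fst h).symm)
    exact ((contains_edges_iff.1 hq.present).2 t).trans hright
  obtain ⟨hb, hl'⟩ := Prod.mk.inj hback
  exact ⟨hright, hback, (hp.eq_of_mem_of_left (he ▸ mem_edgeSet.2 ⟨(s t, false), rfl⟩)
    hl').resolve_right fun h => (hq.proper t).2 (hb.trans (congrArg Prod.fst h).symm)⟩

end Determined

variable {d n m : ℕ} {σ : Matchings d n} {p q : Tour d n (Fin (m + 1))}

theorem IsTour.eq_of_edgeSet_eq (hp : p.IsTour σ (succPerm m)) (hq : q.IsTour σ (succPerm m))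
    (he : q.edgeSet (succPerm m) = p.edgeSet (succPerm m))
    (h0 : (q.fwd 0, q.left 0) = (p.fwd 0, p.left 0)) : q = p := by
  have hall : ∀ t, (q.fwd t, q.left t) = (p.fwd t, p.left t) := by
    intro t
    induction t using Fin.induction with
    | zero => exact h0
    | succ t ih =>
      have := (hp.agree_succ hq he ih).2.2
      rwa [succPerm_apply, Fin.coeSucc_eq_succ] at this
  ext t : 2
  · exact (Prod.mk.inj (hall t)).2
  · exact (hp.agree_succ hq he (hall t)).1
  · exact (Prod.mk.inj (hall t)).1
  · exact (Prod.mk.inj (hp.agree_succ hq he (hall t)).2.1).1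

/-- The tour started at position `r`. -/
def rotate (r : Fin (m + 1)) (p : Tour d n (Fin (m + 1))) : Tour d n (Fin (m + 1)) :=
  ⟨fun t => p.left (r + t), fun t => p.right (r + t), fun t => p.fwd (r + t),
    fun t => p.back (r + t)⟩

/-- The tour in the opposite direction, started with the edge back from position `r`. -/
def reflect (r : Fin (m + 1)) (p : Tour d n (Fin (m + 1))) : Tour d n (Fin (m + 1)) :=
  ⟨fun t => p.left (r - t + 1), fun t => p.right (r - t), fun t => p.back (r - t),
    fun t => p.fwd (r - t)⟩

theorem edge_rotate (r : Fin (m + 1)) (p : Tour d n (Fin (m + 1))) (x : Fin (m + 1) × Bool) :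
    (p.rotate r).edge (succPerm m) x = p.edge (succPerm m) (r + x.1, x.2) := by
  obtain ⟨t, _ | _⟩ := x <;> simp [rotate, add_assoc]

theorem edge_reflect (r : Fin (m + 1)) (p : Tour d n (Fin (m + 1))) (x : Fin (m + 1) × Bool) :
    (p.reflect r).edge (succPerm m) x = p.edge (succPerm m) (r - x.1, !x.2) := by
  obtain ⟨t, _ | _⟩ := x
  · simp [reflect]
  · simp [reflect, show r - (t + 1) + 1 = r - t by abel]

theorem edges_rotate (r : Fin (m + 1)) (p : Tour d n (Fin (m + 1))) :
    (p.rotate r).edges (succPerm m) = p.edges (succPerm m) := by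
  rw [edges, edges, show (p.rotate r).edge (succPerm m) = p.edge (succPerm m) ∘
    ((Equiv.addLeft r).prodCongr (Equiv.refl Bool)) from funext (edge_rotate r p),
    ← Finset.image_image, Finset.image_univ_equiv]

theorem edges_reflect (r : Fin (m + 1)) (p : Tour d n (Fin (m + 1))) :
    (p.reflect r).edges (succPerm m) = p.edges (succPerm m) := by
  rw [edges, edges, show (p.reflect r).edge (succPerm m) = p.edge (succPerm m) ∘
    ((Equiv.subLeft r).prodCongr Equiv.boolNot) from funext (edge_reflect r p),
    ← Finset.image_image, Finset.image_univ_equiv]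

theorem IsTour.rotate (hp : p.IsTour σ (succPerm m)) (r : Fin (m + 1)) :
    (p.rotate r).IsTour σ (succPerm m) where
  left_inj := hp.left_inj.comp (add_right_injective r)
  right_inj := hp.right_inj.comp (add_right_injective r)
  proper t := by simpa [Tour.rotate, add_assoc] using hp.proper (r + t)
  present := by rw [edges_rotate]; exact hp.present

theorem IsTour.reflect (hp : p.IsTour σ (succPerm m)) (r : Fin (m + 1)) :
    (p.reflect r).IsTour σ (succPerm m) where
  left_inj := hp.left_inj.comp ((add_left_injective 1).comp (sub_right_injective (b := r)))
  right_inj := hp.right_inj.comp (sub_right_injective (b := r))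
  proper t := by
    refine ⟨(hp.proper (r - t)).1.symm, ?_⟩
    have := (hp.proper (r - (t + 1))).2
    rw [succPerm_apply, show r - (t + 1) + 1 = r - t by abel] at this
    exact this.symm
  present := by rw [edges_reflect]; exact hp.present

theorem IsTour.card_tours_of_edgeSet (hp : p.IsTour σ (succPerm m)) :
    Nat.card {q : Tour d n (Fin (m + 1)) //
      q.IsTour σ (succPerm m) ∧ q.edgeSet (succPerm m) = p.edgeSet (succPerm m)} =
      2 * (m + 1) := by
  -- A tour of the cycle is determined by its first edge, which can be any edge.
  let first : {q : Tour d n (Fin (m + 1)) //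
      q.IsTour σ (succPerm m) ∧ q.edgeSet (succPerm m) = p.edgeSet (succPerm m)} →
      p.edgeSet (succPerm m) :=
    fun q => ⟨(q.1.fwd 0, q.1.left 0), q.2.2.subset (mem_edgeSet.2 ⟨(0, false), rfl⟩)⟩
  have hfirst : Function.Bijective first := by
    constructor
    · intro q q' h
      exact Subtype.ext (q'.2.1.eq_of_edgeSet_eq q.2.1 (q.2.2.trans q'.2.2.symm)
        (congrArg Subtype.val h))
    · rintro ⟨e, he⟩
      obtain ⟨⟨r, _ | _⟩, rfl⟩ := mem_edgeSet.1 he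
      · refine ⟨⟨p.rotate r, hp.rotate r, congrArg (Finset.image toEdge) (edges_rotate r p)⟩,
          Subtype.ext ?_⟩
        simp [first, Tour.rotate, toEdge]
      · refine ⟨⟨p.reflect r, hp.reflect r, congrArg (Finset.image toEdge) (edges_reflect r p)⟩,
          Subtype.ext ?_⟩
        simp [first, Tour.reflect, toEdge]
  rw [Nat.card_eq_of_bijective first hfirst, Nat.card_eq_fintype_card, Fintype.card_coe,
    hp.proper.card_edgeSet hp.left_inj, Fintype.card_fin]

end Tour

theorem card_injective_lifts {ι T C : Type*} [Fintype ι] [Finite T] [Finite C] (f : T → C) (L : ℕ)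
    (hL : ∀ c, Nat.card {p // f p = c} = L) :
    Nat.card {P : ι → T // Function.Injective (f ∘ P)} =
      L ^ Fintype.card ι * (Nat.card C).descFactorial (Fintype.card ι) := by
  classical
  have := Fintype.ofFinite C
  let g : {P : ι → T // Function.Injective (f ∘ P)} → (ι ↪ C) := fun P => ⟨f ∘ P.1, P.2⟩
  have hfib : ∀ e : ι ↪ C, Nat.card {P // g P = e} = L ^ Fintype.card ι := by
    intro e
    let E : {P // g P = e} ≃ ∀ i, {p // f p = e i} :=
      { toFun := fun P i => ⟨P.1.1 i, congrArg (fun h : ι ↪ C => h i) P.2⟩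
        invFun := fun Q => ⟨⟨fun i => (Q i).1, by
            rw [show f ∘ (fun i => (Q i).1) = e from funext fun i => (Q i).2]
            exact e.injective⟩, DFunLike.ext _ _ fun i => (Q i).2⟩ }
    rw [Nat.card_congr E, Nat.card_pi]
    simp only [hL, Finset.prod_const, Finset.card_univ]
  rw [Nat.card_congr (Equiv.sigmaFiberEquiv g).symm, Nat.card_sigma]
  simp only [hfib, Finset.sum_const, Finset.card_univ, Fintype.card_embedding_eq,
    smul_eq_mul, Nat.card_eq_fintype_card, mul_comm]

theorem card_tour_tuples {d n m : ℕ} {ι : Type*} [Fintype ι] (σ : Matchings d n) :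
    Nat.card {P : ι → Tour d n (Fin (m + 1)) // (∀ i, (P i).IsTour σ (succPerm m)) ∧
      Function.Injective fun i => (P i).edgeSet (succPerm m)} =
      (2 * (m + 1)) ^ Fintype.card ι *
        (numCycles (2 * (m + 1)) σ).descFactorial (Fintype.card ι) := by
  let cycle : {p : Tour d n (Fin (m + 1)) // p.IsTour σ (succPerm m)} →
      {C : Finset (Edge d n) | IsCycle σ (2 * (m + 1)) C} :=
    fun p => ⟨p.1.edgeSet (succPerm m), isCycle_iff_exists_isTour.2 ⟨p.1, p.2, rfl⟩⟩
  have hfib : ∀ C, Nat.card {p // cycle p = C} = 2 * (m + 1) := by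
    rintro ⟨C, hC⟩
    obtain ⟨p, hp, rfl⟩ := isCycle_iff_exists_isTour.1 hC
    refine (Nat.card_congr ?_).trans hp.card_tours_of_edgeSet
    exact
      { toFun := fun q => ⟨q.1.1, q.1.2, congrArg Subtype.val q.2⟩
        invFun := fun q => ⟨⟨q.1, q.2.1⟩, Subtype.ext q.2.2⟩ }
  rw [numCycles, ← Nat.card_coe_set_eq, ← card_injective_lifts cycle (2 * (m + 1)) hfib]
  refine Nat.card_congr ?_
  exact
    { toFun := fun P => ⟨fun i => ⟨P.1 i, P.2.1 i⟩, fun i j h =>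
        P.2.2 (congrArg Subtype.val h)⟩
      invFun := fun P => ⟨fun i => (P.1 i).1, fun i => (P.1 i).2, fun i j h =>
        P.2 (Subtype.ext h)⟩ }

/-! ### Matchings that avoid an independent set and contain prescribed edges -/

section Outcomes

variable {d n : ℕ}

/-- `S ∪ T` is an independent set. -/
def Avoids (S T : Finset (Fin n)) (σ : Matchings d n) : Prop :=
  ∀ k, ∀ u ∈ S, σ k u ∉ T

/-- The edges of `F` in each matching are pairwise disjoint. -/
def IsPartialMatching (F : Finset (PotentialEdge d n)) : Prop :=
  ∀ e ∈ F, ∀ e' ∈ F, e.1 = e'.1 → (e.2.1 = e'.2.1 ∨ e.2.2 = e'.2.2) → e = e'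

/-- No edge of `F` in the same matching as `e` meets `e`. -/
def Misses (F : Finset (PotentialEdge d n)) (e : PotentialEdge d n) : Prop :=
  ∀ f ∈ F, f.1 = e.1 → f.2.1 ≠ e.2.1 ∧ f.2.2 ≠ e.2.2

theorem Contains.isPartialMatching {σ : Matchings d n} {F : Finset (PotentialEdge d n)}
    (h : Contains σ F) : IsPartialMatching F := by
  rintro ⟨k, u, w⟩ he ⟨k', u', w'⟩ he' rfl huw
  obtain rfl : σ k u = w := h _ he
  obtain rfl : σ k u' = w' := h _ he'
  obtain rfl : u = u' := huw.elim id fun hw => (σ k).injective hw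
  rfl

theorem IsPartialMatching.mono {F F' : Finset (PotentialEdge d n)} (h : IsPartialMatching F)
    (hF : F' ⊆ F) : IsPartialMatching F' :=
  fun e he e' he' => h e (hF he) e' (hF he')

theorem IsPartialMatching.misses_of_insert {F : Finset (PotentialEdge d n)} {e : PotentialEdge d n}
    (h : IsPartialMatching (insert e F)) (he : e ∉ F) : Misses F e := by
  have hne f (hf : f ∈ F) (hk : f.1 = e.1) : ¬(f.2.1 = e.2.1 ∨ f.2.2 = e.2.2) := fun hends =>
    he (h f (Finset.mem_insert_of_mem hf) e (Finset.mem_insert_self e F) hk hends ▸ hf)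
  exact fun f hf hk => not_or.1 (hne f hf hk)

open Classical in
/-- The outcomes in which `S ∪ T` is independent and the edges of `F` are present. -/
def outcomes (S T : Finset (Fin n)) (F : Finset (PotentialEdge d n)) : Finset (Matchings d n) :=
  Finset.univ.filter fun σ => Avoids S T σ ∧ Contains σ F

variable {S T : Finset (Fin n)} {F : Finset (PotentialEdge d n)} {σ : Matchings d n}
  {k : Fin d} {u u' w w' : Fin n}

theorem mem_outcomes : σ ∈ outcomes S T F ↔ Avoids S T σ ∧ Contains σ F := by
  simp [outcomes]

theorem contains_insert {e : PotentialEdge d n} :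
    Contains σ (insert e F) ↔ σ e.1 e.2.1 = e.2.2 ∧ Contains σ F :=
  Finset.forall_mem_insert _ _ _

theorem swap_mem_iff {V : Type*} [DecidableEq V] {S : Finset V} {u u' : V} (h : u' ∈ S ↔ u ∈ S)
    (x : V) : Equiv.swap u u' x ∈ S ↔ x ∈ S := by
  rw [Equiv.swap_apply_def]
  split_ifs with hu hu'
  · rw [hu, h]
  · rw [hu', h]
  · rfl

/-- The matching `k` of `σ`, with `u` and `u'` exchanged in `V₁` and `w` and `w'` in `V₂`; the other
matchings are unchanged. -/
def switch (k : Fin d) (u u' w w' : Fin n) (σ : Matchings d n) : Matchings d n :=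
  Function.update σ k (Equiv.swap w w' * σ k * Equiv.swap u u')

theorem switch_injective : Function.Injective (switch (d := d) k u u' w w') := by
  have : Function.Involutive (switch (d := d) k u u' w w') := fun σ => by
    simp [switch, mul_assoc]
  exact this.injective

theorem Avoids.switch (h : Avoids S T σ) (hu : u' ∈ S ↔ u ∈ S) (hw : w' ∈ T ↔ w ∈ T) :
    Avoids S T (switch k u u' w w' σ) := by
  intro k' x hx
  rcases eq_or_ne k' k with rfl | hk
  · rw [BipartiteHardCore.switch, Function.update_self, Equiv.Perm.mul_apply, Equiv.Perm.mul_apply,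
      swap_mem_iff hw]
    exact h _ _ ((swap_mem_iff hu x).2 hx)
  · rw [BipartiteHardCore.switch, Function.update_of_ne hk]
    exact h _ _ hx

theorem Contains.switch (h : Contains σ F) (hF : Misses F (k, u, w)) (hF' : Misses F (k, u', w')) :
    Contains (switch k u u' w w' σ) F := by
  intro e he
  rcases eq_or_ne e.1 k with hk | hk
  · rw [BipartiteHardCore.switch, hk, Function.update_self, Equiv.Perm.mul_apply,
      Equiv.Perm.mul_apply, Equiv.swap_apply_of_ne_of_ne (hF e he hk).1 (hF' e he hk).1, ← hk,
      h e he, Equiv.swap_apply_of_ne_of_ne (hF e he hk).2 (hF' e he hk).2]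
  · rw [BipartiteHardCore.switch, Function.update_of_ne hk, h e he]

theorem card_outcomes_insert_le (hu : u' ∈ S ↔ u ∈ S) (hw : w' ∈ T ↔ w ∈ T)
    (hF : Misses F (k, u, w)) (hF' : Misses F (k, u', w')) :
    (outcomes S T (insert (k, u, w) F)).card ≤ (outcomes S T (insert (k, u', w') F)).card := by
  refine Finset.card_le_card_of_injOn (switch k u u' w w') (fun σ hσ => ?_)
    switch_injective.injOn
  obtain ⟨hA, hC⟩ := mem_outcomes.1 hσ
  obtain ⟨huw, hC⟩ := contains_insert.1 hC
  refine mem_outcomes.2 ⟨hA.switch hu hw, contains_insert.2 ⟨?_, hC.switch hF hF'⟩⟩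
  dsimp only at huw
  simp [switch, huw]

theorem card_outcomes_insert_eq_sum (e : PotentialEdge d n) :
    (outcomes S T (insert e F)).card =
      ∑ σ ∈ outcomes S T F, if σ e.1 e.2.1 = e.2.2 then 1 else 0 := by
  rw [← Finset.card_filter]
  congr 1
  ext σ
  rw [Finset.mem_filter, mem_outcomes, mem_outcomes, contains_insert]
  tauto

/-- The vertices with the same membership in `S` as `u`. -/
def like (S : Finset (Fin n)) (u : Fin n) : Finset (Fin n) :=
  Finset.univ.filter fun u' => u' ∈ S ↔ u ∈ S

/-- The ends, in the part of the graph selected by `f`, of the edges of `F` in the matching `k`. -/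
def usedEnds (F : Finset (PotentialEdge d n)) (f : Fin n × Fin n → Fin n) (k : Fin d) :
    Finset (Fin n) :=
  (F.filter fun e => e.1 = k).image fun e => f e.2

theorem card_usedEnds_le (F : Finset (PotentialEdge d n)) (f : Fin n × Fin n → Fin n) (k : Fin d) :
    (usedEnds F f k).card ≤ F.card :=
  Finset.card_image_le.trans (Finset.card_filter_le _ _)

theorem misses_iff :
    Misses F (k, u, w) ↔ u ∉ usedEnds F Prod.fst k ∧ w ∉ usedEnds F Prod.snd k := by
  simp only [Misses, usedEnds, Finset.mem_image, Finset.mem_filter, not_exists, not_and, and_imp,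
    ← forall_and, ne_eq]

/-- The vertices with the same membership in `S` as `u` that are available in the matching `k` once
the edges of `F` are present. -/
def freeLike (S : Finset (Fin n)) (F : Finset (PotentialEdge d n)) (f : Fin n × Fin n → Fin n)
    (k : Fin d) (u : Fin n) : Finset (Fin n) :=
  like S u \ usedEnds F f k

theorem card_freeLike_mul_card_outcomes (hF : Misses F (k, u, w)) :
    (freeLike S F Prod.fst k u).card * (freeLike T F Prod.snd k w).card *
        (outcomes S T (insert (k, u, w) F)).card =
      ∑ σ ∈ outcomes S T F,
        ((freeLike S F Prod.fst k u).filter fun u' => σ k u' ∈ freeLike T F Prod.snd k w).card := by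
  set P := freeLike S F Prod.fst k u
  set Q := freeLike T F Prod.snd k w
  have hcard : ∀ u' ∈ P, ∀ w' ∈ Q, (outcomes S T (insert (k, u', w') F)).card =
      (outcomes S T (insert (k, u, w) F)).card := by
    intro u' hu' w' hw'
    obtain ⟨hu, hFu⟩ := Finset.mem_sdiff.1 hu'
    obtain ⟨hw, hFw⟩ := Finset.mem_sdiff.1 hw'
    replace hu := (Finset.mem_filter.1 hu).2
    replace hw := (Finset.mem_filter.1 hw).2
    have hF' : Misses F (k, u', w') := misses_iff.2 ⟨hFu, hFw⟩
    exact le_antisymm (card_outcomes_insert_le hu.symm hw.symm hF' hF)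
      (card_outcomes_insert_le hu hw hF hF')
  calc P.card * Q.card * (outcomes S T (insert (k, u, w) F)).card
      = ∑ u' ∈ P, ∑ w' ∈ Q, (outcomes S T (insert (k, u', w') F)).card := by
        rw [Finset.sum_congr rfl fun u' hu' => Finset.sum_congr rfl (hcard u' hu')]
        simp only [Finset.sum_const, smul_eq_mul, mul_assoc]
    _ = ∑ σ ∈ outcomes S T F, ∑ u' ∈ P, ∑ w' ∈ Q, if σ k u' = w' then 1 else 0 := by
        simp only [card_outcomes_insert_eq_sum]
        rw [Finset.sum_comm (s := outcomes S T F)]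
        exact Finset.sum_congr rfl fun u' _ => Finset.sum_comm
    _ = _ := by
        simp only [Finset.sum_ite_eq, Finset.card_filter]

end Outcomes

/-! ### Edge weights -/

section Density

/-- The proportion of a set of density `α` (for `true`) or of its complement. -/
def density (α : ℝ) (b : Bool) : ℝ := if b then α else 1 - α

/-- The limiting relative probability of an edge, given the membership of its ends in the
independent set. -/
def typeWeight (α β : ℝ) (b c : Bool) : ℝ :=
  1 - ((if b then 1 else 0) - α) * ((if c then 1 else 0) - β) / ((1 - α) * (1 - β))

variable {α β : ℝ}

theorem abs_typeWeight_le (hα : 0 ≤ α) (hβ : 0 ≤ β) (hα1 : α < 1) (hβ1 : β < 1) (b c : Bool) :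
    |typeWeight α β b c| ≤ 1 + 1 / ((1 - α) * (1 - β)) := by
  have hdist {x : ℝ} (h0 : 0 ≤ x) (h1 : x < 1) (b : Bool) :
      |(if b then (1 : ℝ) else 0) - x| ≤ 1 := by
    rw [abs_le]
    cases b
    · rw [if_neg Bool.false_ne_true]
      constructor <;> linarith
    · rw [if_pos rfl]
      constructor <;> linarith
  have hpos : 0 < (1 - α) * (1 - β) := mul_pos (by linarith) (by linarith)
  calc |typeWeight α β b c| ≤ |1| + |_| := abs_sub _ _
    _ = 1 + |(if b then 1 else 0) - α| * |(if c then 1 else 0) - β| / ((1 - α) * (1 - β)) := by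
      rw [abs_one, abs_div, abs_mul, abs_of_pos hpos]
    _ ≤ _ := by
      gcongr
      exact mul_le_one₀ (hdist hα hα1 b) (abs_nonneg _) (hdist hβ hβ1 c)

variable {ι : Type*} [Fintype ι] {x y : ι → ℝ}

theorem sum_density (hx : ∑ i, x i = α * Fintype.card ι) (b : Bool) :
    ∑ i, density (x i) b = density α b * Fintype.card ι := by
  cases b <;> simp [density, hx, sub_mul]

theorem sum_density_mul_density (hα : α ≠ 1) (hβ : β ≠ 1) (hx : ∑ i, x i = α * Fintype.card ι)
    (hy : ∑ i, y i = β * Fintype.card ι) (hxy : ∀ i, x i * y i = 0) (b c : Bool) :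
    ∑ i, density (x i) b * density (y i) c =
      density α b * density β c * typeWeight α β b c * Fintype.card ι := by
  have h1 : 1 - α ≠ 0 := sub_ne_zero.2 hα.symm
  have h2 : 1 - β ≠ 0 := sub_ne_zero.2 hβ.symm
  cases b <;> cases c <;>
    simp only [density, typeWeight, if_true, Bool.false_eq_true, if_false, mul_sub, sub_mul, hxy,
      Finset.sum_sub_distrib, mul_one, one_mul, hx, hy, Finset.sum_const, Finset.card_univ,
      nsmul_eq_mul] <;>
    field_simp <;> ring

theorem ite_iff_eq_density (p q : Prop) [Decidable p] [Decidable q] :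
    (if p ↔ q then 1 else 0) = density (if p then 1 else 0) (decide q) := by
  by_cases p <;> by_cases q <;> simp [density, *]

end Density

section Counting

variable {d n : ℕ} {α β : ℝ} {S T : Finset (Fin n)}

/-- The weight of the pair `(u, w)`. -/
def edgeWeight (α β : ℝ) (S T : Finset (Fin n)) (u w : Fin n) : ℝ :=
  typeWeight α β (decide (u ∈ S)) (decide (w ∈ T))

theorem sum_ite_mem (hS : (S.card : ℝ) = α * n) :
    ∑ u, (if u ∈ S then (1 : ℝ) else 0) = α * Fintype.card (Fin n) := by
  simp [hS]

theorem card_like (hS : (S.card : ℝ) = α * n) (u : Fin n) :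
    ((like S u).card : ℝ) = density α (decide (u ∈ S)) * n := by
  have := sum_density (sum_ite_mem hS) (decide (u ∈ S))
  simpa only [like, Finset.natCast_card_filter, ite_iff_eq_density, Fintype.card_fin] using this

theorem card_edges_like (hα : α ≠ 1) (hβ : β ≠ 1) (hS : (S.card : ℝ) = α * n)
    (hT : (T.card : ℝ) = β * n) {π : Equiv.Perm (Fin n)} (hπ : ∀ u ∈ S, π u ∉ T) (u w : Fin n) :
    (((like S u).filter fun u' => π u' ∈ like T w).card : ℝ) =
      density α (decide (u ∈ S)) * density β (decide (w ∈ T)) * edgeWeight α β S T u w * n := by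
  have hdisj x : (if x ∈ S then (1 : ℝ) else 0) * (if π x ∈ T then 1 else 0) = 0 := by
    by_cases hx : x ∈ S
    · rw [if_neg (hπ x hx), mul_zero]
    · rw [if_neg hx, zero_mul]
  have := sum_density_mul_density hα hβ (sum_ite_mem hS)
    ((Equiv.sum_comp π _).trans (sum_ite_mem hT)) hdisj (decide (u ∈ S)) (decide (w ∈ T))
  rw [Fintype.card_fin] at this
  rw [edgeWeight, ← this, Finset.natCast_card_filter, like, Finset.sum_filter]
  simp only [like, Finset.mem_filter, Finset.mem_univ, true_and, ← ite_iff_eq_density, ite_mul,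
    one_mul, zero_mul]

theorem card_sub_le_card_sdiff {V : Type*} [DecidableEq V] (A : Finset V) {B : Finset V} {M : ℕ}
    (hB : B.card ≤ M) : (A.card : ℝ) - M ≤ (A \ B).card := by
  rw [sub_le_iff_le_add]
  exact_mod_cast (Nat.sub_le_iff_le_add.1 (Finset.le_card_sdiff B A)).trans (by gcongr)

variable {F : Finset (PotentialEdge d n)} {M : ℕ}

theorem card_freeLike_bounds (hS : (S.card : ℝ) = α * n) (hF : F.card ≤ M)
    (f : Fin n × Fin n → Fin n) (k : Fin d) (u : Fin n) :
    density α (decide (u ∈ S)) * n - M ≤ (freeLike S F f k u).card ∧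
      ((freeLike S F f k u).card : ℝ) ≤ density α (decide (u ∈ S)) * n := by
  rw [← card_like hS u]
  exact ⟨card_sub_le_card_sdiff _ ((card_usedEnds_le F f k).trans hF),
    Nat.cast_le.2 (Finset.card_le_card Finset.sdiff_subset)⟩

theorem filter_freeLike_eq_sdiff (π : Equiv.Perm (Fin n)) (k : Fin d) (u w : Fin n) :
    ((freeLike S F Prod.fst k u).filter fun u' => π u' ∈ freeLike T F Prod.snd k w) =
      ((like S u).filter fun u' => π u' ∈ like T w) \
        (usedEnds F Prod.fst k ∪ (usedEnds F Prod.snd k).map π.symm.toEmbedding) := by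
  ext x
  simp only [freeLike, Finset.mem_filter, Finset.mem_sdiff, Finset.mem_union,
    Finset.mem_map_equiv, Equiv.symm_symm]
  tauto

theorem card_free_edges_bounds (hα : α ≠ 1) (hβ : β ≠ 1) (hS : (S.card : ℝ) = α * n)
    (hT : (T.card : ℝ) = β * n) (hF : F.card ≤ M) {σ : Matchings d n} (hσ : Avoids S T σ)
    (k : Fin d) (u w : Fin n) :
    density α (decide (u ∈ S)) * density β (decide (w ∈ T)) * edgeWeight α β S T u w * n - 2 * M ≤
      (((freeLike S F Prod.fst k u).filter fun u' => σ k u' ∈ freeLike T F Prod.snd k w).card : ℝ) ∧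
    (((freeLike S F Prod.fst k u).filter fun u' => σ k u' ∈ freeLike T F Prod.snd k w).card : ℝ) ≤
      density α (decide (u ∈ S)) * density β (decide (w ∈ T)) * edgeWeight α β S T u w * n := by
  have hused : (usedEnds F Prod.fst k ∪
      (usedEnds F Prod.snd k).map (σ k).symm.toEmbedding).card ≤ 2 * M := by
    refine (Finset.card_union_le _ _).trans ?_
    rw [Finset.card_map, two_mul]
    gcongr <;> exact (card_usedEnds_le F _ k).trans hF
  rw [← card_edges_like hα hβ hS hT (hσ k) u w, filter_freeLike_eq_sdiff]
  exact ⟨by exact_mod_cast card_sub_le_card_sdiff _ hused,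
    Nat.cast_le.2 (Finset.card_le_card Finset.sdiff_subset)⟩

theorem density_pos (hα : 0 ≤ α) (hα1 : α < 1) (hS : (S.card : ℝ) = α * n) (u : Fin n) :
    0 < density α (decide (u ∈ S)) := by
  by_cases hu : u ∈ S
  · simp only [density, hu, decide_true, if_true]
    refine hα.lt_of_ne fun h => ?_
    rw [← h, zero_mul, Nat.cast_eq_zero, Finset.card_eq_zero] at hS
    simp [hS] at hu
  · simpa [density, hu] using hα1

end Counting

/-! ### Exposing edges one at a time -/

theorem eventually_ratio_bounds {a b : ℝ} (ha : 0 < a) (hb : 0 < b) (c : ℝ) (M : ℕ) {ε : ℝ}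
    (hε : 0 < ε) :
    ∀ᶠ n : ℕ in atTop, 0 < a * n - M ∧ 0 < b * n - M ∧
      a * b * c * n * n ≤ (c + ε) * ((a * n - M) * (b * n - M)) ∧ 2 * M ≤ ε * (a * b) * n := by
  have hn : Tendsto (fun n : ℕ => (n : ℝ)) atTop atTop := tendsto_natCast_atTop_atTop
  have hpos : ∀ x : ℝ, 0 < x → ∀ᶠ n : ℕ in atTop, 0 < x * n - M := fun x hx =>
    ((hn.const_mul_atTop hx).eventually_gt_atTop (M : ℝ)).mono fun n h => sub_pos.2 h
  have hlim : Tendsto (fun n : ℕ => (c + ε) * ((a - M / n) * (b - M / n))) atTop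
      (𝓝 ((c + ε) * ((a - 0) * (b - 0)))) :=
    (((tendsto_const_div_atTop_nhds_zero_nat (M : ℝ)).const_sub a).mul
      ((tendsto_const_div_atTop_nhds_zero_nat (M : ℝ)).const_sub b)).const_mul _
  have hεab : 0 < ε * (a * b) := by positivity
  filter_upwards [hpos a ha, hpos b hb,
    hlim.eventually_const_lt (show a * b * c < _ by linarith), eventually_gt_atTop 0,
    (hn.const_mul_atTop hεab).eventually_ge_atTop (2 * M : ℝ)] with n hna hnb hnc hn0 hnM
  have : (0 : ℝ) < n := by exact_mod_cast hn0
  refine ⟨hna, hnb, ?_, hnM⟩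
  calc a * b * c * n * n ≤ (c + ε) * ((a - M / n) * (b - M / n)) * n * n := by gcongr
    _ = (c + ε) * ((a * n - M) * (b * n - M)) := by field_simp

theorem eventually_forall_type_bounds (α β : ℝ) (M : ℕ) {ε : ℝ} (hε : 0 < ε) :
    ∀ᶠ n : ℕ in atTop, ∀ b c : Bool, 0 < density α b → 0 < density β c →
      0 < density α b * n - M ∧ 0 < density β c * n - M ∧
      density α b * density β c * typeWeight α β b c * n * n ≤
        (typeWeight α β b c + ε) * ((density α b * n - M) * (density β c * n - M)) ∧
      2 * M ≤ ε * (density α b * density β c) * n := by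
  simp only [eventually_all]
  exact fun b c hb hc => eventually_ratio_bounds hb hc _ M hε

theorem abs_mul_sub_le_of_double_count {a b c ε n M p q W W' : ℝ} (hn : 0 < n) (ha : 0 < a)
    (hb : 0 < b) (hW : 0 ≤ W) (hW' : 0 ≤ W') (hp : a * n - M ≤ p ∧ p ≤ a * n)
    (hq : b * n - M ≤ q ∧ q ≤ b * n)
    (hpqW' : (a * b * c * n - 2 * M) * W ≤ p * q * W' ∧ p * q * W' ≤ a * b * c * n * W)
    (hlarge : 0 < a * n - M ∧ 0 < b * n - M ∧
      a * b * c * n * n ≤ (c + ε) * ((a * n - M) * (b * n - M)) ∧ 2 * M ≤ ε * (a * b) * n) :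
    |n * W' - c * W| ≤ ε * W := by
  obtain ⟨haM, hbM, hupper, hlower⟩ := hlarge
  have hp0 : 0 < p := haM.trans_le hp.1
  have hq0 : 0 < q := hbM.trans_le hq.1
  rw [abs_le]
  constructor
  · refine le_of_mul_le_mul_left ?_ (show 0 < a * b * n by positivity)
    have hW'_lower : (a * b * c * n - 2 * M) * W ≤ a * n * (b * n) * W' := by
      refine hpqW'.1.trans ?_
      gcongr
      exacts [hp.2, hq.2]
    linarith [mul_le_mul_of_nonneg_right hlower hW]
  · refine le_of_mul_le_mul_left ?_ (mul_pos haM hbM)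
    have hW'_upper : n * ((a * n - M) * (b * n - M) * W') ≤ n * (a * b * c * n * W) := by
      refine mul_le_mul_of_nonneg_left (le_trans ?_ hpqW'.2) hn.le
      gcongr
      exacts [hp.1, hq.1]
    linarith [mul_le_mul_of_nonneg_right hupper hW]

section CardOutcomes

variable {d : ℕ} {α β : ℝ}

theorem eventually_card_outcomes_insert (d : ℕ) (hα : 0 ≤ α) (hβ : 0 ≤ β) (hα1 : α < 1)
    (hβ1 : β < 1) (M : ℕ) {ε : ℝ} (hε : 0 < ε) :
    ∀ᶠ n : ℕ in atTop, ∀ S T : Finset (Fin n), (S.card : ℝ) = α * n → (T.card : ℝ) = β * n →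
      ∀ F : Finset (PotentialEdge d n), F.card ≤ M → ∀ k u w, Misses F (k, u, w) →
        |n * ((outcomes S T (insert (k, u, w) F)).card : ℝ) -
          edgeWeight α β S T u w * (outcomes S T F).card| ≤ ε * (outcomes S T F).card := by
  filter_upwards [eventually_forall_type_bounds α β M hε, eventually_gt_atTop 0]
    with n hn hn0 S T hS hT F hF k u w hFe
  have ha := density_pos hα hα1 hS u
  have hb := density_pos hβ hβ1 hT w
  have hcount : ((freeLike S F Prod.fst k u).card : ℝ) * (freeLike T F Prod.snd k w).card *
      (outcomes S T (insert (k, u, w) F)).card = ∑ σ ∈ outcomes S T F,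
        (((freeLike S F Prod.fst k u).filter fun u' =>
          σ k u' ∈ freeLike T F Prod.snd k w).card : ℝ) := by
    exact_mod_cast card_freeLike_mul_card_outcomes hFe
  have hedges σ (hσ : σ ∈ outcomes S T F) :=
    card_free_edges_bounds hα1.ne hβ1.ne hS hT hF (mem_outcomes.1 hσ).1 k u w
  refine abs_mul_sub_le_of_double_count (by exact_mod_cast hn0) ha hb (Nat.cast_nonneg _)
    (Nat.cast_nonneg _) (card_freeLike_bounds hS hF Prod.fst k u)
    (card_freeLike_bounds hT hF Prod.snd k w) ?_ (hn _ _ ha hb)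
  rw [hcount, mul_comm _ ((outcomes S T F).card : ℝ), mul_comm _ ((outcomes S T F).card : ℝ),
    ← nsmul_eq_mul, ← nsmul_eq_mul]
  exact ⟨Finset.card_nsmul_le_sum _ _ _ fun σ hσ => (hedges σ hσ).1,
    Finset.sum_le_card_nsmul _ _ _ fun σ hσ => (hedges σ hσ).2⟩

theorem abs_pow_succ_mul_sub_le {N c π P B ε₁ ε₂ W W' W₀ : ℝ} {M : ℕ} (hN : 0 ≤ N) (hW₀ : 0 ≤ W₀)
    (hε₂ : 0 ≤ ε₂) (hc : |c| ≤ B) (hπ : |π| ≤ P) (hW : |N ^ M * W - π * W₀| ≤ ε₁ * W₀)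
    (hW' : |N * W' - c * W| ≤ ε₂ * W) :
    |N ^ (M + 1) * W' - c * π * W₀| ≤ (ε₂ * (P + ε₁) + B * ε₁) * W₀ := by
  have hNW : N ^ M * W ≤ (P + ε₁) * W₀ := by
    have : π * W₀ ≤ P * W₀ := mul_le_mul_of_nonneg_right ((le_abs_self π).trans hπ) hW₀
    linarith [(abs_le.1 hW).2]
  calc |N ^ (M + 1) * W' - c * π * W₀|
      = |N ^ M * (N * W' - c * W) + c * (N ^ M * W - π * W₀)| := by ring_nf
    _ ≤ N ^ M * |N * W' - c * W| + |c| * |N ^ M * W - π * W₀| := by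
        refine (abs_add_le _ _).trans_eq ?_
        rw [abs_mul, abs_mul, abs_of_nonneg (pow_nonneg hN M)]
    _ ≤ N ^ M * (ε₂ * W) + B * (ε₁ * W₀) := by
        gcongr
        exact (abs_nonneg c).trans hc
    _ = ε₂ * (N ^ M * W) + B * ε₁ * W₀ := by ring
    _ ≤ ε₂ * ((P + ε₁) * W₀) + B * ε₁ * W₀ := by gcongr
    _ = _ := by ring

theorem abs_prod_edgeWeight_le (hα : 0 ≤ α) (hβ : 0 ≤ β) (hα1 : α < 1) (hβ1 : β < 1) {n : ℕ}
    (S T : Finset (Fin n)) (F : Finset (PotentialEdge d n)) :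
    |∏ e ∈ F, edgeWeight α β S T e.2.1 e.2.2| ≤ (1 + 1 / ((1 - α) * (1 - β))) ^ F.card := by
  rw [Finset.abs_prod, ← Finset.prod_const]
  exact Finset.prod_le_prod (fun _ _ => abs_nonneg _)
    fun e _ => abs_typeWeight_le hα hβ hα1 hβ1 _ _

theorem eventually_card_outcomes (d : ℕ) (hα : 0 ≤ α) (hβ : 0 ≤ β) (hα1 : α < 1) (hβ1 : β < 1)
    (M : ℕ) {ε : ℝ} (hε : 0 < ε) :
    ∀ᶠ n : ℕ in atTop, ∀ S T : Finset (Fin n), (S.card : ℝ) = α * n → (T.card : ℝ) = β * n →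
      ∀ F : Finset (PotentialEdge d n), F.card = M → IsPartialMatching F →
        |(n : ℝ) ^ M * ((outcomes S T F).card : ℝ) -
          (∏ e ∈ F, edgeWeight α β S T e.2.1 e.2.2) *
            (outcomes S T (∅ : Finset (PotentialEdge d n))).card| ≤
          ε * (outcomes S T (∅ : Finset (PotentialEdge d n))).card := by
  induction M generalizing ε with
  | zero =>
    refine Eventually.of_forall fun n S T _ _ F hF _ => ?_
    obtain rfl := Finset.card_eq_zero.1 hF
    rw [pow_zero, one_mul, Finset.prod_empty, one_mul, sub_self, abs_zero]
    positivity
  | succ M ih =>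
    set B : ℝ := 1 + 1 / ((1 - α) * (1 - β))
    have : 0 < (1 - α) * (1 - β) := mul_pos (by linarith) (by linarith)
    have hB : 0 < B := by positivity
    have hε₁ : 0 < min 1 (ε / (2 * B)) := lt_min one_pos (by positivity)
    have hε₂ : 0 < ε / (2 * (B ^ M + 1)) := by positivity
    filter_upwards [ih hε₁, eventually_card_outcomes_insert d hα hβ hα1 hβ1 M hε₂]
      with n hIH hinsert S T hS hT F hF hPM
    obtain ⟨e, F, he, rfl, rfl⟩ := Finset.card_eq_succ.1 hF
    rw [Finset.prod_insert he]
    refine (abs_pow_succ_mul_sub_le n.cast_nonneg (Nat.cast_nonneg _) hε₂.le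
      (abs_typeWeight_le hα hβ hα1 hβ1 _ _) (abs_prod_edgeWeight_le hα hβ hα1 hβ1 S T F)
      (hIH S T hS hT F rfl (hPM.mono (Finset.subset_insert e F)))
      (hinsert S T hS hT F le_rfl e.1 e.2.1 e.2.2 (hPM.misses_of_insert he))).trans ?_
    gcongr
    calc ε / (2 * (B ^ F.card + 1)) * (B ^ F.card + min 1 (ε / (2 * B))) +
          B * min 1 (ε / (2 * B))
        ≤ ε / (2 * (B ^ F.card + 1)) * (B ^ F.card + 1) + B * (ε / (2 * B)) := by
          gcongr
          exacts [min_le_left _ _, min_le_right _ _]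
      _ = ε := by
          field_simp
          ring

end CardOutcomes

/-! ### Sums over placements of vertices -/

section CardImage

variable {J V : Type*} [Fintype J] [DecidableEq J]

theorem exists_comp_eq_card_image_le [DecidableEq V] (f : J → V) :
    ∃ r : J → J, f ∘ r = f ∧ (Finset.univ.image r).card ≤ (Finset.univ.image f).card := by
  rcases isEmpty_or_nonempty J with hJ | hJ
  · exact ⟨id, rfl, by simp⟩
  · refine ⟨Function.invFun f ∘ f, funext fun t => Function.invFun_eq ⟨t, rfl⟩, ?_⟩
    rw [← Finset.image_image]
    exact Finset.card_image_le

variable [Fintype V] [DecidableEq V]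

theorem card_filter_comp_eq_le (r : J → J) :
    (Finset.univ.filter fun f : J → V => f ∘ r = f).card ≤
      Fintype.card V ^ (Finset.univ.image r).card := by
  rw [← Fintype.card_coe (Finset.univ.image r), ← Fintype.card_fun, ← Finset.card_univ]
  refine Finset.card_le_card_of_injOn (fun f x => f x.1) (fun _ _ => Finset.mem_univ _) ?_
  intro f hf f' hf' h
  replace hf := (Finset.mem_filter.1 hf).2
  replace hf' := (Finset.mem_filter.1 hf').2
  rw [← hf, ← hf']
  exact funext fun t => congrFun h ⟨r t, Finset.mem_image_of_mem r (Finset.mem_univ t)⟩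

theorem sum_inv_pow_card_image_le [Nonempty V] :
    ∑ f : J → V, ((Fintype.card V : ℝ) ^ (Finset.univ.image f).card)⁻¹ ≤
      (Fintype.card J : ℝ) ^ Fintype.card J := by
  have hV : 1 ≤ (Fintype.card V : ℝ) := by exact_mod_cast Fintype.card_pos (α := V)
  let weight (r : J → J) : ℝ := ((Fintype.card V : ℝ) ^ (Finset.univ.image r).card)⁻¹
  have hweight r : 0 ≤ weight r := by positivity
  calc ∑ f : J → V, ((Fintype.card V : ℝ) ^ (Finset.univ.image f).card)⁻¹
      ≤ ∑ f : J → V, ∑ r : J → J, if f ∘ r = f then weight r else 0 := by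
        refine Finset.sum_le_sum fun f _ => ?_
        obtain ⟨r, hr, hcard⟩ := exists_comp_eq_card_image_le f
        rw [← Finset.sum_filter]
        refine le_trans ?_ (Finset.single_le_sum (fun r _ => hweight r)
          (Finset.mem_filter.2 ⟨Finset.mem_univ r, hr⟩))
        exact inv_anti₀ (by positivity) (pow_le_pow_right₀ hV hcard)
    _ = ∑ r : J → J, (Finset.univ.filter fun f : J → V => f ∘ r = f).card * weight r := by
        rw [Finset.sum_comm]
        simp only [← Finset.sum_filter, Finset.sum_const, nsmul_eq_mul]
    _ ≤ ∑ _r : J → J, 1 := by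
        refine Finset.sum_le_sum fun r _ => ?_
        rw [← div_eq_mul_inv, div_le_one (by positivity)]
        exact_mod_cast card_filter_comp_eq_le (V := V) r
    _ = (Fintype.card J : ℝ) ^ Fintype.card J := by simp

end CardImage

section ClosedWalkSum

variable {R ι κ : Type*} [CommRing R] [Fintype ι] [Fintype κ] {b b' : R}
  {h : ι → R} {g : κ → R}

theorem one_add_mul_kernel_pow [DecidableEq ι] (h0 : ∑ u, h u = 0)
    (h2 : ∑ u, h u ^ 2 = b * Fintype.card ι) (a : R) (m : ℕ) :
    (Matrix.of fun u u' => 1 + a * h u * h u') ^ (m + 1) = Matrix.of fun u u' =>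
      (Fintype.card ι : R) ^ m + a * (a * b * Fintype.card ι) ^ m * h u * h u' := by
  induction m with
  | zero => simp
  | succ m ih =>
    rw [pow_succ, ih]
    ext u u'
    have hexpand x : ((Fintype.card ι : R) ^ m + a * (a * b * Fintype.card ι) ^ m * h u * h x) *
        (1 + a * h x * h u') = (Fintype.card ι : R) ^ m +
          (a * (Fintype.card ι : R) ^ m * h u' + a * (a * b * Fintype.card ι) ^ m * h u) * h x +
          a * (a * b * Fintype.card ι) ^ m * a * h u * h u' * h x ^ 2 := by ring
    simp only [Matrix.mul_apply, Matrix.of_apply, hexpand, Finset.sum_add_distrib,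
      ← Finset.mul_sum, h0, h2, Finset.sum_const, Finset.card_univ, nsmul_eq_mul]
    ring

theorem sum_prod_one_add_mul_kernel (h0 : ∑ u, h u = 0)
    (h2 : ∑ u, h u ^ 2 = b * Fintype.card ι) (a : R) (m : ℕ) :
    ∑ f : Fin (m + 1) → ι, ∏ t, (1 + a * h (f t) * h (f (t + 1))) =
      (Fintype.card ι : R) ^ (m + 1) * (1 + (a * b) ^ (m + 1)) := by
  classical
  have htrace := trace_pow_succ_eq_sum_closed_walks (Matrix.of fun u u' => 1 + a * h u * h u') m
  have hdiag u : (Fintype.card ι : R) ^ m + a * (a * b * Fintype.card ι) ^ m * h u * h u =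
      (Fintype.card ι : R) ^ m + a * (a * b * Fintype.card ι) ^ m * h u ^ 2 := by ring
  rw [one_add_mul_kernel_pow h0 h2] at htrace
  simp only [Matrix.trace, Matrix.diag_apply, Matrix.of_apply, hdiag, Finset.sum_add_distrib,
    ← Finset.mul_sum, h2, Finset.sum_const, Finset.card_univ, nsmul_eq_mul] at htrace
  rw [← htrace]
  ring

theorem sum_bipartite_kernel_closed_walks (h0 : ∑ u, h u = 0)
    (h2 : ∑ u, h u ^ 2 = b * Fintype.card ι) (g0 : ∑ w, g w = 0)
    (g2 : ∑ w, g w ^ 2 = b' * Fintype.card κ) (γ : R) (m : ℕ) :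
    ∑ q : (Fin (m + 1) → ι) × (Fin (m + 1) → κ),
      ∏ t, ((1 - γ * h (q.1 t) * g (q.2 t)) * (1 - γ * h (q.1 (t + 1)) * g (q.2 t))) =
      (Fintype.card κ : R) ^ (m + 1) *
        ((Fintype.card ι : R) ^ (m + 1) * (1 + (γ ^ 2 * b' * b) ^ (m + 1))) := by
  classical
  have htwo u u' : ∑ w, (1 - γ * h u * g w) * (1 - γ * h u' * g w) =
      Fintype.card κ * (1 + γ ^ 2 * b' * h u * h u') := by
    have hexpand w : (1 - γ * h u * g w) * (1 - γ * h u' * g w) =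
        1 - γ * (h u + h u') * g w + γ ^ 2 * h u * h u' * g w ^ 2 := by ring
    simp only [hexpand, Finset.sum_add_distrib, Finset.sum_sub_distrib, ← Finset.mul_sum, g0, g2,
      Finset.sum_const, Finset.card_univ, nsmul_eq_mul]
    ring
  have hinner (f : Fin (m + 1) → ι) : ∑ y : Fin (m + 1) → κ,
      ∏ t, ((1 - γ * h (f t) * g (y t)) * (1 - γ * h (f (t + 1)) * g (y t))) =
      (Fintype.card κ : R) ^ (m + 1) * ∏ t, (1 + γ ^ 2 * b' * h (f t) * h (f (t + 1))) := by
    rw [← Fintype.prod_sum fun t w => (1 - γ * h (f t) * g w) * (1 - γ * h (f (t + 1)) * g w)]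
    simp only [htwo, Finset.prod_mul_distrib, Finset.prod_const, Finset.card_univ, Fintype.card_fin]
  rw [Fintype.sum_prod_type]
  simp only [hinner]
  rw [← Finset.mul_sum, sum_prod_one_add_mul_kernel h0 h2]

end ClosedWalkSum

section EdgeWeightWalks

variable {n : ℕ} {α β : ℝ} {S T : Finset (Fin n)}

theorem sum_ite_mem_sub (hS : (S.card : ℝ) = α * n) :
    ∑ u, ((if u ∈ S then (1 : ℝ) else 0) - α) = 0 := by
  rw [Finset.sum_sub_distrib, sum_ite_mem hS, Finset.sum_const, Finset.card_univ, nsmul_eq_mul,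
    mul_comm, sub_self]

theorem sum_ite_mem_sub_sq (hS : (S.card : ℝ) = α * n) :
    ∑ u, ((if u ∈ S then (1 : ℝ) else 0) - α) ^ 2 = α * (1 - α) * Fintype.card (Fin n) := by
  have hexpand u : ((if u ∈ S then (1 : ℝ) else 0) - α) ^ 2 =
      (1 - 2 * α) * (if u ∈ S then (1 : ℝ) else 0) + α ^ 2 := by split_ifs <;> ring
  simp only [hexpand, Finset.sum_add_distrib, ← Finset.mul_sum]
  rw [sum_ite_mem hS, Finset.sum_const, Finset.card_univ, nsmul_eq_mul]
  ring

theorem edgeWeight_eq (α β : ℝ) (S T : Finset (Fin n)) (u w : Fin n) :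
    edgeWeight α β S T u w = 1 - 1 / ((1 - α) * (1 - β)) * ((if u ∈ S then 1 else 0) - α) *
      ((if w ∈ T then 1 else 0) - β) := by
  simp only [edgeWeight, typeWeight, decide_eq_true_eq]
  ring

theorem sum_edgeWeight_walks (m : ℕ) (hα : α ≠ 1) (hβ : β ≠ 1) (hS : (S.card : ℝ) = α * n)
    (hT : (T.card : ℝ) = β * n) :
    ∑ q : (Fin (m + 1) → Fin n) × (Fin (m + 1) → Fin n),
      ∏ t, (edgeWeight α β S T (q.1 t) (q.2 t) * edgeWeight α β S T (q.1 (t + 1)) (q.2 t)) =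
      (n : ℝ) ^ (2 * (m + 1)) * (1 + del α β (2 * (m + 1))) := by
  have hα1 : 1 - α ≠ 0 := sub_ne_zero.2 hα.symm
  have hβ1 : 1 - β ≠ 0 := sub_ne_zero.2 hβ.symm
  simp only [edgeWeight_eq]
  rw [sum_bipartite_kernel_closed_walks (sum_ite_mem_sub hS) (sum_ite_mem_sub_sq hS)
    (sum_ite_mem_sub hT) (sum_ite_mem_sub_sq hT), Fintype.card_fin, ← mul_assoc, ← pow_add,
    ← two_mul, del, Nat.mul_div_cancel_left _ two_pos]
  congr 3
  field_simp

end EdgeWeightWalks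

/-! ### Overlapping tours -/

section CardFiber

variable {E V J : Type*} [Fintype J] [DecidableEq V] {F : Finset E} {f : E → V} {v : J → V}
  {P : J → Finset E} {k : ℕ}

theorem mul_card_image_le_of_subset_fiber (hF : ∀ e ∈ F, ∃ t, f e = v t)
    (hP : ∀ t, P t ⊆ F.filter fun e => f e = v t) (hcard : ∀ t, (P t).card = k) :
    k * (Finset.univ.image v).card ≤ F.card := by
  refine Finset.mul_card_image_le_card_of_maps_to (f := f) (fun e he => ?_) k ?_
  · obtain ⟨t, ht⟩ := hF e he
    exact ht ▸ Finset.mem_image_of_mem v (Finset.mem_univ t)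
  · rw [Finset.forall_mem_image]
    exact fun t _ => hcard t ▸ Finset.card_le_card (hP t)

theorem fiber_eq_of_card_le (hF : ∀ e ∈ F, ∃ t, f e = v t)
    (hP : ∀ t, P t ⊆ F.filter fun e => f e = v t) (hcard : ∀ t, (P t).card = k)
    (hle : F.card ≤ k * (Finset.univ.image v).card) (t : J) :
    (F.filter fun e => f e = v t) = P t := by
  have hfiber : ∀ y ∈ Finset.univ.image v, k ≤ (F.filter fun e => f e = y).card := by
    rw [Finset.forall_mem_image]
    exact fun t _ => hcard t ▸ Finset.card_le_card (hP t)
  have hsum : F.card = ∑ y ∈ Finset.univ.image v, (F.filter fun e => f e = y).card := by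
    refine Finset.card_eq_sum_card_fiberwise fun e he => ?_
    obtain ⟨t, ht⟩ := hF e he
    exact ht ▸ Finset.mem_coe.2 (Finset.mem_image_of_mem v (Finset.mem_univ t))
  have heq : ∑ _y ∈ Finset.univ.image v, k =
      ∑ y ∈ Finset.univ.image v, (F.filter fun e => f e = y).card := by
    rw [← hsum, Finset.sum_const, smul_eq_mul, mul_comm]
    exact (mul_card_image_le_of_subset_fiber hF hP hcard).antisymm hle
  have ht := (Finset.sum_eq_sum_iff_of_le hfiber).1 heq (v t)
    (Finset.mem_image_of_mem v (Finset.mem_univ t))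
  exact (Finset.eq_of_subset_of_card_le (hP t) (by rw [hcard, ht])).symm

end CardFiber

namespace Tour

section Degree

variable {d n : ℕ} {J : Type*} {s : Equiv.Perm J} {p : Tour d n J}

/-- The two edges of a tour at its `t`-th vertex in `V₁`. -/
def edgesAtLeft (s : Equiv.Perm J) (p : Tour d n J) (t : J) : Finset (PotentialEdge d n) :=
  {p.edge s (t, false), p.edge s (s.symm t, true)}

/-- The two edges of a tour at its `t`-th vertex in `V₂`. -/
def edgesAtRight (s : Equiv.Perm J) (p : Tour d n J) (t : J) : Finset (PotentialEdge d n) :=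
  {p.edge s (t, false), p.edge s (t, true)}

theorem Proper.card_edgesAtLeft (hp : p.Proper s) (t : J) : (p.edgesAtLeft s t).card = 2 :=
  Finset.card_pair fun h => (hp (s.symm t)).2 <| by
    rw [Equiv.apply_symm_apply]
    exact (congrArg Prod.fst h).symm

theorem Proper.card_edgesAtRight (hp : p.Proper s) (t : J) : (p.edgesAtRight s t).card = 2 :=
  Finset.card_pair fun h => (hp t).1 (congrArg Prod.fst h)

variable [Fintype J]

theorem exists_left_eq {e : PotentialEdge d n} (he : e ∈ p.edges s) : ∃ t, e.2.1 = p.left t := by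
  obtain ⟨⟨t, _ | _⟩, -, rfl⟩ := Finset.mem_image.1 he
  exacts [⟨t, rfl⟩, ⟨s t, rfl⟩]

theorem exists_right_eq {e : PotentialEdge d n} (he : e ∈ p.edges s) :
    ∃ t, e.2.2 = p.right t := by
  obtain ⟨⟨t, _ | _⟩, -, rfl⟩ := Finset.mem_image.1 he
  exacts [⟨t, rfl⟩, ⟨t, rfl⟩]

theorem edgesAtLeft_subset (t : J) :
    p.edgesAtLeft s t ⊆ (p.edges s).filter fun e => e.2.1 = p.left t := by
  rw [edgesAtLeft, Finset.insert_subset_iff, Finset.singleton_subset_iff, Finset.mem_filter,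
    Finset.mem_filter]
  exact ⟨⟨edge_mem_edges _ _ _, rfl⟩, edge_mem_edges _ _ _, by simp⟩

theorem edgesAtRight_subset (t : J) :
    p.edgesAtRight s t ⊆ (p.edges s).filter fun e => e.2.2 = p.right t := by
  rw [edgesAtRight, Finset.insert_subset_iff, Finset.singleton_subset_iff, Finset.mem_filter,
    Finset.mem_filter]
  exact ⟨⟨edge_mem_edges _ _ _, rfl⟩, edge_mem_edges _ _ _, by simp⟩

/-- The number of distinct vertices of a tour. -/
def numVertices (p : Tour d n J) : ℕ :=
  (Finset.univ.image p.left).card + (Finset.univ.image p.right).card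

theorem Proper.filter_left_eq (hp : p.Proper s) (hcard : (p.edges s).card ≤ p.numVertices)
    (t : J) :
    ((p.edges s).filter fun e => e.2.1 = p.left t) = p.edgesAtLeft s t := by
  refine fiber_eq_of_card_le (fun _ => exists_left_eq) edgesAtLeft_subset hp.card_edgesAtLeft ?_ t
  rw [numVertices] at hcard
  have := mul_card_image_le_of_subset_fiber (fun _ => exists_right_eq) edgesAtRight_subset
    hp.card_edgesAtRight
  omega

theorem Proper.filter_right_eq (hp : p.Proper s) (hcard : (p.edges s).card ≤ p.numVertices)
    (t : J) :
    ((p.edges s).filter fun e => e.2.2 = p.right t) = p.edgesAtRight s t := by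
  refine fiber_eq_of_card_le (fun _ => exists_right_eq) edgesAtRight_subset
    hp.card_edgesAtRight ?_ t
  rw [numVertices] at hcard
  have := mul_card_image_le_of_subset_fiber (fun _ => exists_left_eq) edgesAtLeft_subset
    hp.card_edgesAtLeft
  omega

end Degree

end Tour

section Family

variable {ι : Type*}

/-- Positions in a family of cycles, the `x`-th of which has length `2 (j x + 1)`. -/
abbrev Positions (j : ι → ℕ) : Type _ := Σ x, Fin (j x + 1)

/-- The successor on each cycle of a family. -/
def familySucc (j : ι → ℕ) : Equiv.Perm (Positions j) :=
  Equiv.sigmaCongrRight fun x => succPerm (j x)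

@[simp] theorem familySucc_apply (j : ι → ℕ) (x : ι) (t : Fin (j x + 1)) :
    familySucc j ⟨x, t⟩ = ⟨x, t + 1⟩ := rfl

@[simp] theorem familySucc_symm_apply (j : ι → ℕ) (x : ι) (t : Fin (j x + 1)) :
    (familySucc j).symm ⟨x, t⟩ = ⟨x, t - 1⟩ := by
  rw [Equiv.symm_apply_eq, familySucc_apply, sub_add_cancel]

end Family

namespace Tour

variable {d n : ℕ} {ι : Type*} {j : ι → ℕ}

/-- The `x`-th member of a family of tours. -/
def component (p : Tour d n (Positions j)) (x : ι) : Tour d n (Fin (j x + 1)) :=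
  ⟨fun t => p.left ⟨x, t⟩, fun t => p.right ⟨x, t⟩, fun t => p.fwd ⟨x, t⟩, fun t => p.back ⟨x, t⟩⟩

theorem edge_component (p : Tour d n (Positions j)) (x : ι) (y : Fin (j x + 1) × Bool) :
    (p.component x).edge (succPerm (j x)) y = p.edge (familySucc j) (⟨x, y.1⟩, y.2) := by
  obtain ⟨t, _ | _⟩ := y <;> rfl

theorem edge_mem_edges_component (p : Tour d n (Positions j)) (x : ι) (t : Fin (j x + 1))
    (b : Bool) : p.edge (familySucc j) (⟨x, t⟩, b) ∈ (p.component x).edges (succPerm (j x)) :=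
  edge_component p x (t, b) ▸ edge_mem_edges _ _ _

theorem edgesAtLeft_subset_edges_component (p : Tour d n (Positions j)) (x : ι)
    (t : Fin (j x + 1)) :
    p.edgesAtLeft (familySucc j) ⟨x, t⟩ ⊆ (p.component x).edges (succPerm (j x)) := by
  rw [edgesAtLeft, familySucc_symm_apply, Finset.insert_subset_iff, Finset.singleton_subset_iff]
  exact ⟨edge_mem_edges_component p x t false, edge_mem_edges_component p x (t - 1) true⟩

theorem edgesAtRight_subset_edges_component (p : Tour d n (Positions j)) (x : ι)
    (t : Fin (j x + 1)) :
    p.edgesAtRight (familySucc j) ⟨x, t⟩ ⊆ (p.component x).edges (succPerm (j x)) := by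
  rw [edgesAtRight, Finset.insert_subset_iff, Finset.singleton_subset_iff]
  exact ⟨edge_mem_edges_component p x t false, edge_mem_edges_component p x t true⟩

variable [Fintype ι] {p : Tour d n (Positions j)}

theorem mem_edges_component_of_left_eq (hp : p.Proper (familySucc j))
    (hcard : (p.edges (familySucc j)).card ≤ p.numVertices)
    {x : ι} {t : Fin (j x + 1)} {e : PotentialEdge d n}
    (he : e ∈ p.edges (familySucc j)) (h : e.2.1 = p.left ⟨x, t⟩) :
    e ∈ (p.component x).edges (succPerm (j x)) :=
  edgesAtLeft_subset_edges_component p x t <|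
    hp.filter_left_eq hcard ⟨x, t⟩ ▸ Finset.mem_filter.2 ⟨he, h⟩

theorem mem_edges_component_of_right_eq (hp : p.Proper (familySucc j))
    (hcard : (p.edges (familySucc j)).card ≤ p.numVertices)
    {x : ι} {t : Fin (j x + 1)} {e : PotentialEdge d n}
    (he : e ∈ p.edges (familySucc j)) (h : e.2.2 = p.right ⟨x, t⟩) :
    e ∈ (p.component x).edges (succPerm (j x)) :=
  edgesAtRight_subset_edges_component p x t <|
    hp.filter_right_eq hcard ⟨x, t⟩ ▸ Finset.mem_filter.2 ⟨he, h⟩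

theorem edges_component_subset_of_left_eq (hp : p.Proper (familySucc j))
    (hcard : (p.edges (familySucc j)).card ≤ p.numVertices)
    {x y : ι} {a : Fin (j x + 1)} {b : Fin (j y + 1)}
    (h : p.left ⟨x, a⟩ = p.left ⟨y, b⟩) :
    (p.component y).edges (succPerm (j y)) ⊆ (p.component x).edges (succPerm (j x)) := by
  have edges_at (t : Fin (j y + 1)) (ht : ∃ τ, p.left ⟨y, t⟩ = p.left ⟨x, τ⟩) (c : Bool) :
      p.edge (familySucc j) (⟨y, t⟩, c) ∈ (p.component x).edges (succPerm (j x)) := by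
    obtain ⟨τ, hτ⟩ := ht
    have hfalse : p.edge (familySucc j) (⟨y, t⟩, false) ∈ (p.component x).edges _ :=
      mem_edges_component_of_left_eq hp hcard (edge_mem_edges _ p _) hτ
    obtain ⟨τ', hτ'⟩ := exists_right_eq hfalse
    cases c
    · exact hfalse
    · exact mem_edges_component_of_right_eq hp hcard (edge_mem_edges _ p _) hτ'
  have left_mem (r : Fin (j y + 1)) : ∃ τ, p.left ⟨y, b + r⟩ = p.left ⟨x, τ⟩ := by
    induction r using Fin.induction with
    | zero => exact ⟨a, by rw [add_zero, h]⟩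
    | succ r ih =>
      rw [← Fin.coeSucc_eq_succ, ← add_assoc]
      exact exists_left_eq (edges_at _ ih true)
  intro e he
  obtain ⟨⟨t, c⟩, -, rfl⟩ := Finset.mem_image.1 he
  rw [edge_component]
  refine edges_at t ?_ c
  simpa only [add_sub_cancel] using left_mem (t - b)

theorem numVertices_lt_card_edges (hp : p.Proper (familySucc j))
    (hl : ∀ x, Function.Injective (p.component x).left)
    (hr : ∀ x, Function.Injective (p.component x).right)
    (hne : Pairwise fun x y =>
      (p.component x).edgeSet (succPerm _) ≠ (p.component y).edgeSet (succPerm _))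
    (hmeet : ¬ (Function.Injective p.left ∧ Function.Injective p.right)) :
    p.numVertices < (p.edges (familySucc j)).card := by
  by_contra! hcard
  have eq_of_left {x y : ι} {a : Fin (j x + 1)} {b : Fin (j y + 1)}
      (h : p.left ⟨x, a⟩ = p.left ⟨y, b⟩) : x = y := by
    by_contra hxy
    exact hne hxy (congrArg (Finset.image toEdge)
      ((edges_component_subset_of_left_eq hp hcard h.symm).antisymm
        (edges_component_subset_of_left_eq hp hcard h)))
  refine hmeet ⟨?_, ?_⟩
  · rintro ⟨x, a⟩ ⟨y, b⟩ h
    obtain rfl := eq_of_left h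
    rw [hl x h]
  · rintro ⟨x, a⟩ ⟨y, b⟩ h
    have he := mem_edges_component_of_right_eq hp hcard
      (edge_mem_edges _ p (⟨x, a⟩, false)) h
    obtain ⟨τ, hτ⟩ := exists_left_eq he
    obtain rfl := eq_of_left hτ
    rw [hr x h]

end Tour

/-! ### Families of tours and factorial moments of cycle counts -/

namespace Tour

section Weight

variable {d n : ℕ} {J : Type*} {s : Equiv.Perm J} {p : Tour d n J}

theorem Proper.edge_injective (hp : p.Proper s) (hl : Function.Injective p.left) :
    Function.Injective (p.edge s) :=
  Function.Injective.of_comp (f := toEdge) (hp.toEdge_edge_injective hl)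

variable [Fintype J]

theorem card_edges_le (s : Equiv.Perm J) (p : Tour d n J) :
    (p.edges s).card ≤ 2 * Fintype.card J := by
  refine Finset.card_image_le.trans_eq ?_
  rw [Finset.card_univ, Fintype.card_prod, Fintype.card_bool, mul_comm]

theorem Proper.card_edges (hp : p.Proper s) (hl : Function.Injective p.left) :
    (p.edges s).card = 2 * Fintype.card J := by
  rw [edges, Finset.card_image_of_injective _ (hp.edge_injective hl), Finset.card_univ,
    Fintype.card_prod, Fintype.card_bool, mul_comm]

theorem Proper.isPartialMatching_edges (hp : p.Proper s) (hl : Function.Injective p.left)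
    (hr : Function.Injective p.right) : IsPartialMatching (p.edges s) := by
  intro e he e' he' hk huw
  obtain ⟨⟨t, b⟩, -, rfl⟩ := Finset.mem_image.1 he
  obtain ⟨⟨t', b'⟩, -, rfl⟩ := Finset.mem_image.1 he'
  rcases huw with h | h
  · rw [hp.toEdge_edge_injective hl (Prod.ext hk h)]
  · obtain rfl : t = t' := by cases b <;> cases b' <;> exact hr h
    cases b <;> cases b'
    · rfl
    · exact absurd hk (hp t).1
    · exact absurd hk.symm (hp t).1
    · rfl

/-- The product of the weights of the edges of a tour, with multiplicity. -/
def weight (α β : ℝ) (S T : Finset (Fin n)) (s : Equiv.Perm J) (p : Tour d n J) : ℝ :=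
  ∏ t, (edgeWeight α β S T (p.left t) (p.right t) * edgeWeight α β S T (p.left (s t)) (p.right t))

theorem Proper.prod_edges (hp : p.Proper s) (hl : Function.Injective p.left) (α β : ℝ)
    (S T : Finset (Fin n)) :
    ∏ e ∈ p.edges s, edgeWeight α β S T e.2.1 e.2.2 = p.weight α β S T s := by
  rw [edges, Finset.prod_image (hp.edge_injective hl).injOn, Fintype.prod_prod_type]
  refine Finset.prod_congr rfl fun t _ => ?_
  rw [Fintype.prod_bool, mul_comm]
  rfl

theorem abs_weight_le {α β : ℝ} (hα : 0 ≤ α) (hβ : 0 ≤ β) (hα1 : α < 1) (hβ1 : β < 1)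
    (S T : Finset (Fin n)) (s : Equiv.Perm J) (p : Tour d n J) :
    |p.weight α β S T s| ≤ (1 + 1 / ((1 - α) * (1 - β))) ^ (2 * Fintype.card J) := by
  rw [weight, Finset.abs_prod, pow_mul, ← Finset.card_univ, ← Finset.prod_const]
  refine Finset.prod_le_prod (fun _ _ => abs_nonneg _) fun t _ => ?_
  have hedge (u w : Fin n) : |edgeWeight α β S T u w| ≤ 1 + 1 / ((1 - α) * (1 - β)) :=
    abs_typeWeight_le hα hβ hα1 hβ1 _ _
  rw [abs_mul, pow_two]
  exact mul_le_mul (hedge _ _) (hedge _ _) (abs_nonneg _)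
    ((abs_nonneg _).trans (hedge (p.left t) (p.right t)))

end Weight

section Family

variable {d n : ℕ} {ι : Type*} {j : ι → ℕ}

/-- A family of tours is a choice of its members. -/
def familyEquiv (d n : ℕ) (j : ι → ℕ) :
    Tour d n (Positions j) ≃ ∀ x, Tour d n (Fin (j x + 1)) where
  toFun p x := p.component x
  invFun q := ⟨fun t => (q t.1).left t.2, fun t => (q t.1).right t.2, fun t => (q t.1).fwd t.2,
    fun t => (q t.1).back t.2⟩

/-- The members of the family are tours of pairwise distinct cycles of the multigraph. -/
def IsFamily (σ : Matchings d n) (p : Tour d n (Positions j)) : Prop :=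
  (∀ x, (p.component x).IsTour σ (succPerm (j x))) ∧
    Pairwise fun x y => (p.component x).edgeSet (succPerm _) ≠ (p.component y).edgeSet (succPerm _)

/-- The conditions for a family of tours of distinct cycles that do not involve the matchings. -/
structure IsPattern (p : Tour d n (Positions j)) : Prop where
  proper : p.Proper (familySucc j)
  left_inj : ∀ x, Function.Injective (p.component x).left
  right_inj : ∀ x, Function.Injective (p.component x).right
  edgeSet_ne : Pairwise fun x y =>
    (p.component x).edgeSet (succPerm _) ≠ (p.component y).edgeSet (succPerm _)

theorem proper_iff_component (p : Tour d n (Positions j)) :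
    p.Proper (familySucc j) ↔ ∀ x, (p.component x).Proper (succPerm (j x)) :=
  ⟨fun h x t => h ⟨x, t⟩, fun h t => h t.1 t.2⟩

theorem contains_edges_iff_component [Fintype ι] {σ : Matchings d n} {p : Tour d n (Positions j)} :
    Contains σ (p.edges (familySucc j)) ↔
      ∀ x, Contains σ ((p.component x).edges (succPerm (j x))) := by
  simp only [Contains, edges, Finset.forall_mem_image, Finset.mem_univ, true_imp_iff,
    edge_component]
  exact ⟨fun h x y => @h (⟨x, y.1⟩, y.2), fun h x => @h x.1.1 (x.1.2, x.2)⟩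

theorem isFamily_iff [Fintype ι] (σ : Matchings d n) (p : Tour d n (Positions j)) :
    p.IsFamily σ ↔ p.IsPattern ∧ Contains σ (p.edges (familySucc j)) := by
  rw [contains_edges_iff_component]
  constructor
  · rintro ⟨htour, hne⟩
    exact ⟨⟨(proper_iff_component p).2 fun x => (htour x).proper, fun x => (htour x).left_inj,
      fun x => (htour x).right_inj, hne⟩, fun x => (htour x).present⟩
  · rintro ⟨hp, hσ⟩
    exact ⟨fun x => ⟨hp.left_inj x, hp.right_inj x, (proper_iff_component p).1 hp.proper x, hσ x⟩,
      hp.edgeSet_ne⟩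

theorem Proper.isPattern_of_injective {p : Tour d n (Positions j)} (hp : p.Proper (familySucc j))
    (hl : Function.Injective p.left) (hr : Function.Injective p.right) : p.IsPattern where
  proper := hp
  left_inj _ := hl.comp sigma_mk_injective
  right_inj _ := hr.comp sigma_mk_injective
  edgeSet_ne x y hxy h := by
    have hmem : toEdge ((p.component x).edge _ (0, false)) ∈ (p.component y).edgeSet (succPerm _) :=
      h ▸ mem_edgeSet.2 ⟨(0, false), rfl⟩
    obtain ⟨⟨t, _ | _⟩, ht⟩ := mem_edgeSet.1 hmem <;>
    exact hxy (congrArg Sigma.fst (hl (congrArg Prod.snd ht))).symm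

theorem IsTour.length_eq_of_edgeSet_eq {m m' : ℕ} {σ : Matchings d n}
    {p : Tour d n (Fin (m + 1))} {q : Tour d n (Fin (m' + 1))} (hp : p.IsTour σ (succPerm m))
    (hq : q.IsTour σ (succPerm m')) (h : p.edgeSet (succPerm m) = q.edgeSet (succPerm m')) :
    m = m' := by
  have hcard := congrArg Finset.card h
  rw [hp.proper.card_edgeSet hp.left_inj, hq.proper.card_edgeSet hq.left_inj, Fintype.card_fin,
    Fintype.card_fin] at hcard
  omega

/-- Cycles of different lengths are different, so a family of tours of distinct cycles consists of
one such family for each length. -/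
def isFamilyEquiv {κ : Type*} {A : κ → Type*} {ℓ : κ → ℕ} (hℓ : Function.Injective ℓ)
    (σ : Matchings d n) :
    {p : Tour d n (Positions fun x : Σ i, A i => ℓ x.1) // p.IsFamily σ} ≃
      ∀ i, {P : A i → Tour d n (Fin (ℓ i + 1)) // (∀ a, (P a).IsTour σ (succPerm (ℓ i))) ∧
        Function.Injective fun a => (P a).edgeSet (succPerm (ℓ i))} where
  toFun p i := ⟨fun a => p.1.component ⟨i, a⟩, fun a => p.2.1 ⟨i, a⟩, fun a b h => by
    by_contra hne
    exact p.2.2 (sigma_mk_injective.ne hne) h⟩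
  invFun Q := ⟨(familyEquiv d n _).symm fun x => (Q x.1).1 x.2, fun x => (Q x.1).2.1 x.2, by
    rintro ⟨i, a⟩ ⟨i', a'⟩ hne h
    change ((Q i).1 a).edgeSet (succPerm _) = ((Q i').1 a').edgeSet (succPerm _) at h
    obtain rfl : i = i' := hℓ (((Q i).2.1 a).length_eq_of_edgeSet_eq ((Q i').2.1 a') h)
    exact hne (congrArg (Sigma.mk i) ((Q i).2.2 h))⟩
  left_inv _ := rfl
  right_inv _ := rfl

theorem card_isFamily {κ : Type*} [Fintype κ] {A : κ → Type*} [∀ i, Fintype (A i)] {ℓ : κ → ℕ}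
    (hℓ : Function.Injective ℓ) (σ : Matchings d n) :
    Nat.card {p : Tour d n (Positions fun x : Σ i, A i => ℓ x.1) // p.IsFamily σ} =
      ∏ i, (2 * (ℓ i + 1)) ^ Fintype.card (A i) *
        (numCycles (2 * (ℓ i + 1)) σ).descFactorial (Fintype.card (A i)) := by
  rw [Nat.card_congr (isFamilyEquiv hℓ σ), Nat.card_pi]
  exact Finset.prod_congr rfl fun i _ => card_tour_tuples σ

end Family

end Tour

/-! ### The total weight of all patterns -/

section TotalWeight

theorem properColorings_eq_card_pairs (d m : ℕ) :
    properColorings d (2 * (m + 1)) =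
      Nat.card {c : (Fin (m + 1) → Fin d) × (Fin (m + 1) → Fin d) //
        ∀ t, c.1 t ≠ c.2 t ∧ c.2 t ≠ c.1 (succPerm m t)} := by
  let split : (Fin (2 * (m + 1)) → Fin d) ≃ (Fin (m + 1) → Fin d) × (Fin (m + 1) → Fin d) :=
    ((interleave m).arrowCongr (Equiv.refl _)).symm.trans
      { toFun := fun c => (fun t => c (t, false), fun t => c (t, true))
        invFun := fun q x => cond x.2 (q.2 x.1) (q.1 x.1)
        left_inv := fun c => by ext ⟨t, _ | _⟩ <;> rfl
        right_inv := fun q => rfl }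
  rw [properColorings, ← Nat.card_eq_fintype_card]
  refine Nat.card_congr (split.subtypeEquiv fun c => ?_)
  rw [← (interleave m).forall_congr_right]
  simp only [finRotate_interleave, Prod.forall, Bool.forall_bool, stepPerm_false, stepPerm_true]
  rfl

namespace Tour

variable {d n : ℕ} {α β : ℝ} {S T : Finset (Fin n)}

open Classical in
theorem sum_weight_proper_eq {J : Type*} [Fintype J] [DecidableEq J] (d : ℕ) (α β : ℝ)
    (S T : Finset (Fin n)) (s : Equiv.Perm J) :
    ∑ p : Tour d n J, (if p.Proper s then p.weight α β S T s else 0) =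
      Nat.card {c : (J → Fin d) × (J → Fin d) // ∀ t, c.1 t ≠ c.2 t ∧ c.2 t ≠ c.1 (s t)} *
        ∑ q : (J → Fin n) × (J → Fin n),
          ∏ t, (edgeWeight α β S T (q.1 t) (q.2 t) * edgeWeight α β S T (q.1 (s t)) (q.2 t)) := by
  rw [← (equivProd d n J).symm.sum_comp, Fintype.sum_prod_type, Finset.mul_sum]
  refine Finset.sum_congr rfl fun q _ => ?_
  rw [← Finset.sum_filter, Nat.card_eq_fintype_card, Fintype.card_subtype, ← nsmul_eq_mul,
    ← Finset.sum_const]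
  refine Finset.sum_congr (Finset.ext fun c => ?_) fun _ _ => rfl
  rw [Finset.mem_filter_univ, Finset.mem_filter_univ]
  rfl

open Classical in
theorem sum_weight_cycle (d m : ℕ) (hα : α ≠ 1) (hβ : β ≠ 1) (hS : (S.card : ℝ) = α * n)
    (hT : (T.card : ℝ) = β * n) :
    ∑ p : Tour d n (Fin (m + 1)),
      (if p.Proper (succPerm m) then p.weight α β S T (succPerm m) else 0) =
      (n : ℝ) ^ (2 * (m + 1)) *
        (properColorings d (2 * (m + 1)) * (1 + del α β (2 * (m + 1)))) := by
  rw [sum_weight_proper_eq, ← properColorings_eq_card_pairs]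
  simp only [succPerm_apply]
  rw [sum_edgeWeight_walks m hα hβ hS hT]
  ring

open Classical in
theorem sum_weight_family {ι : Type*} [Fintype ι] [DecidableEq ι] (d : ℕ) (j : ι → ℕ) (hα : α ≠ 1)
    (hβ : β ≠ 1) (hS : (S.card : ℝ) = α * n) (hT : (T.card : ℝ) = β * n) :
    ∑ p : Tour d n (Positions j),
      (if p.Proper (familySucc j) then p.weight α β S T (familySucc j) else 0) =
      (n : ℝ) ^ (2 * Fintype.card (Positions j)) *
        ∏ x, (properColorings d (2 * (j x + 1)) * (1 + del α β (2 * (j x + 1)))) := by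
  let cycleWeight (x : ι) (q : Tour d n (Fin (j x + 1))) : ℝ :=
    if q.Proper (succPerm (j x)) then q.weight α β S T (succPerm (j x)) else 0
  calc ∑ p : Tour d n (Positions j),
        (if p.Proper (familySucc j) then p.weight α β S T (familySucc j) else 0)
      = ∑ p : Tour d n (Positions j), ∏ x, cycleWeight x (familyEquiv d n j p x) := by
        refine Finset.sum_congr rfl fun p _ => ?_
        rw [Finset.prod_ite_zero, weight, Fintype.prod_sigma]
        simp only [Finset.mem_univ, true_imp_iff]
        exact if_congr (proper_iff_component p) rfl rfl
    _ = ∏ x, ∑ q, cycleWeight x q := by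
        rw [(familyEquiv d n j).sum_comp fun q => ∏ x, cycleWeight x (q x), Finset.prod_univ_sum,
          Fintype.piFinset_univ]
    _ = _ := by
        simp only [cycleWeight, sum_weight_cycle d _ hα hβ hS hT]
        rw [Finset.prod_mul_distrib, Finset.prod_pow_eq_pow_sum, ← Finset.mul_sum,
          Fintype.card_sigma]
        simp only [Fintype.card_fin]

end Tour

end TotalWeight

/-! ### Asymptotics of the joint factorial moments -/

theorem eventually_card_outcomes_le (d : ℕ) {α β : ℝ} (hα : 0 ≤ α) (hβ : 0 ≤ β) (hα1 : α < 1)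
    (hβ1 : β < 1) (N : ℕ) :
    ∀ᶠ n : ℕ in atTop, ∀ S T : Finset (Fin n), (S.card : ℝ) = α * n → (T.card : ℝ) = β * n →
      ∀ F : Finset (PotentialEdge d n), F.card ≤ N →
        (n : ℝ) ^ F.card * ((outcomes S T F).card : ℝ) ≤
          ((1 + 1 / ((1 - α) * (1 - β))) ^ N + 1) *
            (outcomes S T (∅ : Finset (PotentialEdge d n))).card := by
  have hB : 1 ≤ 1 + 1 / ((1 - α) * (1 - β)) :=
    le_add_of_nonneg_right (one_div_nonneg.2 (mul_nonneg (by linarith) (by linarith)))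
  filter_upwards [eventually_all.2 fun M : Fin (N + 1) =>
    eventually_card_outcomes d hα hβ hα1 hβ1 M one_pos] with n hn S T hS hT F hF
  obtain hempty | ⟨σ, hσ⟩ := (outcomes S T F).eq_empty_or_nonempty
  · rw [hempty, Finset.card_empty, Nat.cast_zero, mul_zero]
    positivity
  have hclose := (abs_le.1 (hn ⟨F.card, Nat.lt_succ_of_le hF⟩ S T hS hT F rfl
    (mem_outcomes.1 hσ).2.isPartialMatching)).2
  have hprod : ∏ e ∈ F, edgeWeight α β S T e.2.1 e.2.2 ≤ (1 + 1 / ((1 - α) * (1 - β))) ^ N :=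
    (le_abs_self _).trans ((abs_prod_edgeWeight_le hα hβ hα1 hβ1 S T F).trans
      (pow_le_pow_right₀ hB hF))
  rw [add_mul]
  exact (sub_le_iff_le_add'.1 hclose).trans (by gcongr)

/-- Approximate formula for `outcomes S T F` when `F` has `N` edges, and an upper bound of the right
order when `F` has at most `N` edges. -/
structure OutcomeEstimates (d : ℕ) {n : ℕ} (α β : ℝ) (S T : Finset (Fin n)) (N : ℕ) (ε C : ℝ) :
    Prop where
  abs_sub_le : ∀ F : Finset (PotentialEdge d n), F.card = N → IsPartialMatching F →
    |(n : ℝ) ^ N * ((outcomes S T F).card : ℝ) - (∏ e ∈ F, edgeWeight α β S T e.2.1 e.2.2) *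
        (outcomes S T (∅ : Finset (PotentialEdge d n))).card| ≤
      ε * (outcomes S T (∅ : Finset (PotentialEdge d n))).card
  le : ∀ F : Finset (PotentialEdge d n), F.card ≤ N → (n : ℝ) ^ F.card * (outcomes S T F).card ≤
    C * (outcomes S T (∅ : Finset (PotentialEdge d n))).card

theorem eventually_outcomeEstimates (d : ℕ) {α β : ℝ} (hα : 0 ≤ α) (hβ : 0 ≤ β) (hα1 : α < 1)
    (hβ1 : β < 1) (N : ℕ) {ε : ℝ} (hε : 0 < ε) :
    ∀ᶠ n : ℕ in atTop, ∀ S T : Finset (Fin n), (S.card : ℝ) = α * n → (T.card : ℝ) = β * n →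
      OutcomeEstimates d α β S T N ε ((1 + 1 / ((1 - α) * (1 - β))) ^ N + 1) := by
  filter_upwards [eventually_card_outcomes d hα hβ hα1 hβ1 N hε,
    eventually_card_outcomes_le d hα hβ hα1 hβ1 N] with n hclose hle S T hS hT
  exact ⟨hclose S T hS hT, hle S T hS hT⟩

theorem card_image_add_card_image_lt {J V W : Type*} [Fintype J] [DecidableEq V] [DecidableEq W]
    {f : J → V} {g : J → W} (h : ¬(Function.Injective f ∧ Function.Injective g)) :
    (Finset.univ.image f).card + (Finset.univ.image g).card < 2 * Fintype.card J := by
  have hf : (Finset.univ.image f).card ≤ Fintype.card J := Finset.card_image_le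
  have hg : (Finset.univ.image g).card ≤ Fintype.card J := Finset.card_image_le
  refine lt_of_not_ge fun hle => h ⟨?_, ?_⟩ <;>
  · rw [← Set.injOn_univ, ← Finset.coe_univ, ← Finset.card_image_iff, Finset.card_univ]
    omega

namespace Tour

theorem sum_inv_pow_numVertices_le {d n : ℕ} {J : Type*} [Fintype J] [DecidableEq J]
    (hn : n ≠ 0) :
    ∑ p : Tour d n J, ((n : ℝ) ^ p.numVertices)⁻¹ ≤
      ((Fintype.card J : ℝ) ^ Fintype.card J) ^ 2 * (d : ℝ) ^ (2 * Fintype.card J) := by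
  have : Nonempty (Fin n) := Fin.pos_iff_nonempty.1 (Nat.pos_of_ne_zero hn)
  have hplaces := sum_inv_pow_card_image_le (J := J) (V := Fin n)
  rw [Fintype.card_fin] at hplaces
  rw [← (equivProd d n J).symm.sum_comp, Fintype.sum_prod_type]
  calc ∑ q : (J → Fin n) × (J → Fin n), ∑ c : (J → Fin d) × (J → Fin d),
        ((n : ℝ) ^ ((equivProd d n J).symm (q, c)).numVertices)⁻¹
      = (∑ f : J → Fin n, ((n : ℝ) ^ (Finset.univ.image f).card)⁻¹) ^ 2 *
          (d : ℝ) ^ (2 * Fintype.card J) := by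
        simp only [numVertices, equivProd, Equiv.coe_fn_symm_mk, Finset.sum_const, Finset.card_univ,
          Fintype.card_prod, Fintype.card_fun, Fintype.card_fin, nsmul_eq_mul, ← Finset.mul_sum]
        rw [Fintype.sum_prod_type]
        simp only [pow_add, mul_inv, ← Fintype.sum_mul_sum]
        push_cast
        ring
    _ ≤ _ := by gcongr

theorem card_eq (d n : ℕ) (J : Type*) [Fintype J] [DecidableEq J] :
    Fintype.card (Tour d n J) = n ^ (2 * Fintype.card J) * d ^ (2 * Fintype.card J) := by
  rw [Fintype.card_congr (equivProd d n J)]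
  simp only [Fintype.card_prod, Fintype.card_fun, Fintype.card_fin]
  ring

theorem sum_le_of_forall_le {d n : ℕ} {J : Type*} [Fintype J] [DecidableEq J] (hn : n ≠ 0)
    {a : Tour d n J → ℝ} {A E : ℝ} (hE : 0 ≤ E)
    (ha : ∀ p, a p ≤ A * ((n : ℝ) ^ (2 * Fintype.card J))⁻¹ +
      E * ((n : ℝ)⁻¹ * ((n : ℝ) ^ p.numVertices)⁻¹)) :
    ∑ p, a p ≤ (d : ℝ) ^ (2 * Fintype.card J) *
      (A + E * ((Fintype.card J : ℝ) ^ Fintype.card J) ^ 2 / n) := by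
  have : (0 : ℝ) < n := by exact_mod_cast Nat.pos_of_ne_zero hn
  calc ∑ p, a p
      ≤ (Fintype.card (Tour d n J) : ℝ) * (A * ((n : ℝ) ^ (2 * Fintype.card J))⁻¹) +
          E * ((n : ℝ)⁻¹ * ∑ p : Tour d n J, ((n : ℝ) ^ p.numVertices)⁻¹) := by
        refine (Finset.sum_le_sum fun p _ => ha p).trans_eq ?_
        rw [Finset.sum_add_distrib, Finset.sum_const, Finset.card_univ, nsmul_eq_mul,
          ← Finset.mul_sum, ← Finset.mul_sum]
    _ ≤ (Fintype.card (Tour d n J) : ℝ) * (A * ((n : ℝ) ^ (2 * Fintype.card J))⁻¹) +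
          E * ((n : ℝ)⁻¹ * (((Fintype.card J : ℝ) ^ Fintype.card J) ^ 2 *
            (d : ℝ) ^ (2 * Fintype.card J))) := by
        gcongr
        exact sum_inv_pow_numVertices_le hn
    _ = _ := by
        rw [card_eq]
        push_cast
        field_simp

section Comparison

variable {d n : ℕ} {ι : Type*} [Fintype ι] {j : ι → ℕ} {α β ε C : ℝ} {S T : Finset (Fin n)}
  {p : Tour d n (Positions j)}

theorem Proper.abs_card_outcomes_sub_le (hn : n ≠ 0)
    (hcount : OutcomeEstimates d α β S T (2 * Fintype.card (Positions j)) ε C)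
    (hp : p.Proper (familySucc j)) (hl : Function.Injective p.left)
    (hr : Function.Injective p.right) :
    |((outcomes S T (p.edges (familySucc j))).card : ℝ) -
        ((n : ℝ) ^ (2 * Fintype.card (Positions j)))⁻¹ * p.weight α β S T (familySucc j) *
          (outcomes S T (∅ : Finset (PotentialEdge d n))).card| ≤
      ε * (outcomes S T (∅ : Finset (PotentialEdge d n))).card *
        ((n : ℝ) ^ (2 * Fintype.card (Positions j)))⁻¹ := by
  have : (0 : ℝ) < n := by exact_mod_cast Nat.pos_of_ne_zero hn
  have hclose := hcount.abs_sub_le _ (hp.card_edges hl) (hp.isPartialMatching_edges hl hr)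
  rw [hp.prod_edges hl] at hclose
  rw [← div_eq_mul_inv, le_div_iff₀ (by positivity), ← abs_of_pos (a := (n : ℝ) ^ _)
    (by positivity), ← abs_mul, abs_of_pos (a := (n : ℝ) ^ _) (by positivity)]
  refine le_of_eq_of_le (congrArg abs ?_) hclose
  field_simp

theorem inv_pow_le_of_numVertices_lt {J : Type*} [Fintype J] {q : Tour d n J} (hn : n ≠ 0) {M : ℕ}
    (hM : q.numVertices < M) : ((n : ℝ) ^ M)⁻¹ ≤ (n : ℝ)⁻¹ * ((n : ℝ) ^ q.numVertices)⁻¹ := by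
  have hn1 : (1 : ℝ) ≤ n := by exact_mod_cast Nat.pos_of_ne_zero hn
  rw [← mul_inv, ← pow_succ']
  gcongr
  exact hM

theorem IsPattern.card_outcomes_le (hn : n ≠ 0) (hC : 0 ≤ C)
    (hcount : OutcomeEstimates d α β S T (2 * Fintype.card (Positions j)) ε C)
    (hp : p.IsPattern) (hmeet : ¬(Function.Injective p.left ∧ Function.Injective p.right)) :
    ((outcomes S T (p.edges (familySucc j))).card : ℝ) ≤
      C * (outcomes S T (∅ : Finset (PotentialEdge d n))).card *
        ((n : ℝ)⁻¹ * ((n : ℝ) ^ p.numVertices)⁻¹) := by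
  have : (0 : ℝ) < n := by exact_mod_cast Nat.pos_of_ne_zero hn
  calc ((outcomes S T (p.edges (familySucc j))).card : ℝ)
      ≤ C * (outcomes S T (∅ : Finset (PotentialEdge d n))).card *
          ((n : ℝ) ^ (p.edges (familySucc j)).card)⁻¹ := by
        rw [← div_eq_mul_inv, le_div_iff₀ (by positivity), mul_comm]
        exact hcount.le _ (card_edges_le _ p)
    _ ≤ _ := by
        gcongr
        exact inv_pow_le_of_numVertices_lt hn (numVertices_lt_card_edges hp.proper hp.left_inj
          hp.right_inj hp.edgeSet_ne hmeet)

theorem abs_weight_mul_le {J : Type*} [Fintype J] {q : Tour d n J} (hα : 0 ≤ α) (hβ : 0 ≤ β)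
    (hα1 : α < 1) (hβ1 : β < 1) (hn : n ≠ 0) {W : ℝ} (hW : 0 ≤ W) (s : Equiv.Perm J)
    (hmeet : ¬(Function.Injective q.left ∧ Function.Injective q.right)) :
    |((n : ℝ) ^ (2 * Fintype.card J))⁻¹ * q.weight α β S T s * W| ≤
      (1 + 1 / ((1 - α) * (1 - β))) ^ (2 * Fintype.card J) * W *
        ((n : ℝ)⁻¹ * ((n : ℝ) ^ q.numVertices)⁻¹) := by
  rw [abs_mul, abs_mul, abs_of_nonneg hW, abs_of_nonneg (by positivity),
    mul_comm (((n : ℝ) ^ (2 * Fintype.card J))⁻¹), mul_right_comm]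
  refine mul_le_mul (mul_le_mul_of_nonneg_right (abs_weight_le hα hβ hα1 hβ1 S T s q) hW)
    (inv_pow_le_of_numVertices_lt hn (card_image_add_card_image_lt hmeet)) (by positivity) ?_
  exact mul_nonneg ((abs_nonneg _).trans (abs_weight_le hα hβ hα1 hβ1 S T s q)) hW

open Classical in
theorem abs_pattern_count_sub_le (hα : 0 ≤ α) (hβ : 0 ≤ β) (hα1 : α < 1) (hβ1 : β < 1)
    (hn : n ≠ 0) (hε : 0 ≤ ε) (hC : 0 ≤ C)
    (hcount : OutcomeEstimates d α β S T (2 * Fintype.card (Positions j)) ε C)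
    (p : Tour d n (Positions j)) :
    |(if p.IsPattern then ((outcomes S T (p.edges (familySucc j))).card : ℝ) else 0) -
        (if p.Proper (familySucc j) then
          ((n : ℝ) ^ (2 * Fintype.card (Positions j)))⁻¹ * p.weight α β S T (familySucc j) *
            (outcomes S T (∅ : Finset (PotentialEdge d n))).card else 0)| ≤
      ε * (outcomes S T (∅ : Finset (PotentialEdge d n))).card *
          ((n : ℝ) ^ (2 * Fintype.card (Positions j)))⁻¹ +
        (C + (1 + 1 / ((1 - α) * (1 - β))) ^ (2 * Fintype.card (Positions j))) *
          (outcomes S T (∅ : Finset (PotentialEdge d n))).card *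
            ((n : ℝ)⁻¹ * ((n : ℝ) ^ p.numVertices)⁻¹) := by
  have : 0 ≤ 1 + 1 / ((1 - α) * (1 - β)) :=
    add_nonneg one_pos.le (one_div_nonneg.2 (mul_nonneg (by linarith) (by linarith)))
  by_cases hp : p.Proper (familySucc j)
  swap
  · rw [if_neg fun h => hp h.proper, if_neg hp, sub_zero, abs_zero]
    positivity
  rw [if_pos hp]
  by_cases hinj : Function.Injective p.left ∧ Function.Injective p.right
  · rw [if_pos (hp.isPattern_of_injective hinj.1 hinj.2)]
    exact (hp.abs_card_outcomes_sub_le hn hcount hinj.1 hinj.2).trans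
      (le_add_of_nonneg_right (by positivity))
  refine (abs_sub _ _).trans (le_trans ?_ (le_add_of_nonneg_left (by positivity)))
  rw [add_mul, add_mul]
  refine add_le_add ?_ (abs_weight_mul_le hα hβ hα1 hβ1 hn (Nat.cast_nonneg _) _ hinj)
  split_ifs with hpattern
  · rw [Nat.abs_cast]
    exact hpattern.card_outcomes_le hn hC hcount hinj
  · rw [abs_zero]
    positivity

open Classical in
theorem abs_sum_pattern_count_sub_le [DecidableEq ι] (hα : 0 ≤ α) (hβ : 0 ≤ β) (hα1 : α < 1)
    (hβ1 : β < 1) (hn : n ≠ 0) (hε : 0 ≤ ε) (hC : 0 ≤ C) (hS : (S.card : ℝ) = α * n)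
    (hT : (T.card : ℝ) = β * n)
    (hcount : OutcomeEstimates d α β S T (2 * Fintype.card (Positions j)) ε C) :
    |∑ p : Tour d n (Positions j),
          (if p.IsPattern then ((outcomes S T (p.edges (familySucc j))).card : ℝ) else 0) -
        (∏ x, (properColorings d (2 * (j x + 1)) * (1 + del α β (2 * (j x + 1))))) *
          (outcomes S T (∅ : Finset (PotentialEdge d n))).card| ≤
      (d : ℝ) ^ (2 * Fintype.card (Positions j)) *
        (ε + (C + (1 + 1 / ((1 - α) * (1 - β))) ^ (2 * Fintype.card (Positions j))) *
          ((Fintype.card (Positions j) : ℝ) ^ Fintype.card (Positions j)) ^ 2 / n) *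
        (outcomes S T (∅ : Finset (PotentialEdge d n))).card := by
  have hn0 : (n : ℝ) ≠ 0 := Nat.cast_ne_zero.2 hn
  have : 0 ≤ 1 + 1 / ((1 - α) * (1 - β)) :=
    add_nonneg one_pos.le (one_div_nonneg.2 (mul_nonneg (by linarith) (by linarith)))
  have hmain : (∏ x, (properColorings d (2 * (j x + 1)) * (1 + del α β (2 * (j x + 1))))) *
      (outcomes S T (∅ : Finset (PotentialEdge d n))).card =
      ∑ p : Tour d n (Positions j), (if p.Proper (familySucc j) then
        ((n : ℝ) ^ (2 * Fintype.card (Positions j)))⁻¹ * p.weight α β S T (familySucc j) *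
          (outcomes S T (∅ : Finset (PotentialEdge d n))).card else 0) := by
    rw [← inv_mul_cancel_left₀ (pow_ne_zero (2 * Fintype.card (Positions j)) hn0) (∏ _, _),
      ← sum_weight_family d j hα1.ne hβ1.ne hS hT, Finset.mul_sum, Finset.sum_mul]
    simp only [mul_ite, ite_mul, mul_zero, zero_mul]
  rw [hmain, ← Finset.sum_sub_distrib]
  refine (Finset.abs_sum_le_sum_abs _ _).trans ((sum_le_of_forall_le hn (by positivity)
    (abs_pattern_count_sub_le hα hβ hα1 hβ1 hn hε hC hcount)).trans_eq ?_)
  ring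

end Comparison

open Classical in
theorem eventually_sum_patterns {ι : Type*} [Fintype ι] [DecidableEq ι] (d : ℕ) (j : ι → ℕ)
    {α β : ℝ} (hα : 0 ≤ α) (hβ : 0 ≤ β) (hα1 : α < 1) (hβ1 : β < 1) {ε : ℝ} (hε : 0 < ε) :
    ∀ᶠ n : ℕ in atTop, ∀ S T : Finset (Fin n), (S.card : ℝ) = α * n → (T.card : ℝ) = β * n →
      |∑ p : Tour d n (Positions j), (if p.IsPattern then
          ((outcomes S T (p.edges (familySucc j))).card : ℝ) else 0) -
        (∏ x, (properColorings d (2 * (j x + 1)) * (1 + del α β (2 * (j x + 1))))) *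
          (outcomes S T (∅ : Finset (PotentialEdge d n))).card| ≤
        ε * (outcomes S T (∅ : Finset (PotentialEdge d n))).card := by
  set D : ℝ := (d : ℝ) ^ (2 * Fintype.card (Positions j))
  set B : ℝ := (1 + 1 / ((1 - α) * (1 - β))) ^ (2 * Fintype.card (Positions j))
  set R : ℝ := ((Fintype.card (Positions j) : ℝ) ^ Fintype.card (Positions j)) ^ 2
  have hB : 0 ≤ B := pow_nonneg (add_nonneg one_pos.le
    (one_div_nonneg.2 (mul_nonneg (by linarith) (by linarith)))) _
  have hD : 0 ≤ D := by positivity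
  set η : ℝ := ε / (2 * (D + 1))
  have hη : 0 < η := by positivity
  have hsmall : ∀ᶠ n : ℕ in atTop, (B + 1 + B) * R / n < η :=
    (tendsto_const_div_atTop_nhds_zero_nat _).eventually_lt_const hη
  filter_upwards [eventually_outcomeEstimates d hα hβ hα1 hβ1 _ hη, hsmall, eventually_ne_atTop 0]
    with n hcount hsmall hn S T hS hT
  refine (abs_sum_pattern_count_sub_le hα hβ hα1 hβ1 hn hη.le (add_nonneg hB one_pos.le) hS hT
    (hcount S T hS hT)).trans ?_
  gcongr
  calc D * (η + (B + 1 + B) * R / n) ≤ (D + 1) * (η + η) := by gcongr; linarith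
    _ = ε := by
      simp only [η]
      field_simp
      ring

open Classical in
theorem sum_card_isFamily {d n : ℕ} {ι : Type*} [Fintype ι] [DecidableEq ι] (j : ι → ℕ)
    (S T : Finset (Fin n)) :
    ∑ σ ∈ outcomes S T (∅ : Finset (PotentialEdge d n)),
      (Nat.card {p : Tour d n (Positions j) // p.IsFamily σ} : ℝ) =
      ∑ p : Tour d n (Positions j), (if p.IsPattern then
          ((outcomes S T (p.edges (familySucc j))).card : ℝ) else 0) := by
  simp only [Nat.card_eq_fintype_card, Fintype.card_subtype, ← Finset.sum_boole]
  rw [Finset.sum_comm]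
  refine Finset.sum_congr rfl fun p _ => ?_
  rw [Finset.sum_boole, ← Nat.cast_zero, ← apply_ite]
  congr 1
  split_ifs with hp
  · congr 1
    ext σ
    simp only [Finset.mem_filter, mem_outcomes, isFamily_iff, hp, true_and, Contains,
      Finset.notMem_empty, false_imp_iff, implies_true, and_true]
  · rw [Finset.card_eq_zero, Finset.filter_eq_empty_iff]
    exact fun σ _ h => hp ((isFamily_iff σ p).1 h).1

end Tour

theorem eventually_sum_descFactorial (d : ℕ) {α β : ℝ} (hα : 0 ≤ α) (hβ : 0 ≤ β) (hα1 : α < 1)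
    (hβ1 : β < 1) {k : ℕ} (m : Fin k → ℕ) {ε : ℝ} (hε : 0 < ε) :
    ∀ᶠ n : ℕ in atTop, ∀ S T : Finset (Fin n), (S.card : ℝ) = α * n → (T.card : ℝ) = β * n →
      |∑ σ ∈ outcomes S T (∅ : Finset (PotentialEdge d n)),
          ∏ i : Fin k, ((evenCycles d n i σ).descFactorial (m i) : ℝ) -
        (∏ i : Fin k, (evenLam d i * (1 + evenDel α β i)) ^ m i) *
          (outcomes S T (∅ : Finset (PotentialEdge d n))).card| ≤
        ε * (outcomes S T (∅ : Finset (PotentialEdge d n))).card := by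
  let j (x : Σ i : Fin k, Fin (m i)) : ℕ := x.1
  let rotations : ℝ := ∏ i : Fin k, (2 * ((i : ℝ) + 1)) ^ m i
  have hrot : 0 < rotations := Finset.prod_pos fun i _ => by positivity
  have hfamilies {n : ℕ} (σ : Matchings d n) :
      (Nat.card {p : Tour d n (Positions j) // p.IsFamily σ} : ℝ) =
        rotations * ∏ i : Fin k, ((evenCycles d n i σ).descFactorial (m i) : ℝ) := by
    rw [Tour.card_isFamily Fin.val_injective, ← Finset.prod_mul_distrib]
    simp only [Fintype.card_fin]
    push_cast
    rfl
  have hlimit : ∏ x, ((properColorings d (2 * (j x + 1)) : ℝ) * (1 + del α β (2 * (j x + 1)))) =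
      rotations * ∏ i : Fin k, (evenLam d i * (1 + evenDel α β i)) ^ m i := by
    rw [Fintype.prod_sigma, ← Finset.prod_mul_distrib]
    refine Finset.prod_congr rfl fun i _ => ?_
    simp only [j, Finset.prod_const, Finset.card_univ, Fintype.card_fin]
    rw [← mul_pow, evenLam, evenDel, lam]
    congr 1
    push_cast
    field_simp
  filter_upwards [Tour.eventually_sum_patterns d j hα hβ hα1 hβ1 (mul_pos hrot hε)]
    with n hn S T hS hT
  have hclose := hn S T hS hT
  simp only [← Tour.sum_card_isFamily, hfamilies, hlimit, ← Finset.mul_sum] at hclose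
  rw [mul_assoc, ← mul_sub, abs_mul, abs_of_pos hrot, mul_assoc] at hclose
  exact le_of_mul_le_mul_left hclose hrot

/-! ### Averaging over the independent sets -/

open Classical in
/-- The pairs `(S, T)` of vertex sets of the sizes counted by `numIndep α β`. -/
def sizedPairs (α β : ℝ) (n : ℕ) : Finset (Finset (Fin n) × Finset (Fin n)) :=
  {q | (q.1.card : ℝ) = α * n ∧ (q.2.card : ℝ) = β * n}

theorem mem_sizedPairs {α β : ℝ} {n : ℕ} {q : Finset (Fin n) × Finset (Fin n)} :
    q ∈ sizedPairs α β n ↔ (q.1.card : ℝ) = α * n ∧ (q.2.card : ℝ) = β * n := by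
  simp [sizedPairs]

theorem mem_outcomes_empty {d n : ℕ} {S T : Finset (Fin n)} {σ : Matchings d n} :
    σ ∈ outcomes S T (∅ : Finset (PotentialEdge d n)) ↔ Avoids S T σ := by
  simp [mem_outcomes, Contains]

theorem numIndep_eq_card_filter {d n : ℕ} (α β : ℝ) (σ : Matchings d n)
    [DecidablePred fun q : Finset (Fin n) × Finset (Fin n) => Avoids q.1 q.2 σ] :
    numIndep α β σ = ((sizedPairs α β n).filter fun q => Avoids q.1 q.2 σ).card := by
  rw [numIndep, ← Set.ncard_coe_finset]
  congr 1
  ext q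
  rw [Finset.mem_coe, Finset.mem_filter, mem_sizedPairs]
  exact and_assoc.symm

theorem sum_numIndep_mul {d n : ℕ} (α β : ℝ) (f : Matchings d n → ℝ) :
    ∑ σ : Matchings d n, (numIndep α β σ : ℝ) * f σ =
      ∑ q ∈ sizedPairs α β n, ∑ σ ∈ outcomes q.1 q.2 (∅ : Finset (PotentialEdge d n)), f σ := by
  classical
  simp only [numIndep_eq_card_filter, ← nsmul_eq_mul, ← Finset.sum_const]
  exact Finset.sum_comm' fun σ q => by simp [mem_outcomes_empty, and_comm]

theorem sum_numIndep {d n : ℕ} (α β : ℝ) :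
    ∑ σ : Matchings d n, (numIndep α β σ : ℝ) =
      ∑ q ∈ sizedPairs α β n, ((outcomes q.1 q.2 (∅ : Finset (PotentialEdge d n))).card : ℝ) := by
  simpa using sum_numIndep_mul (d := d) (n := n) α β fun _ => 1

theorem exists_disjoint_mem_sizedPairs {n : ℕ} {α β : ℝ} (hαβ : α + β ≤ 1)
    (hn : n ∈ admissible α β) : ∃ q ∈ sizedPairs α β n, Disjoint q.1 q.2 := by
  obtain ⟨a, b, ha, hb⟩ := hn
  have hab : a + b ≤ n := by
    have : (a : ℝ) + b ≤ n := by
      rw [ha, hb, ← add_mul]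
      exact mul_le_of_le_one_left (Nat.cast_nonneg n) hαβ
    exact_mod_cast this
  obtain ⟨S, -, hS⟩ := Finset.exists_subset_card_eq
    (s := (Finset.univ : Finset (Fin n))) (n := a) (by simp; omega)
  obtain ⟨T, hTS, hT⟩ := Finset.exists_subset_card_eq
    (s := Sᶜ) (n := b) (by rw [Finset.card_compl, Fintype.card_fin, hS]; omega)
  exact ⟨(S, T), mem_sizedPairs.2 (by simp [hS, hT, ha, hb]),
    (Finset.subset_compl_iff_disjoint_left.1 hTS)⟩

theorem expect_numIndep_pos {d n : ℕ} {α β : ℝ} (hαβ : α + β ≤ 1) (hn : n ∈ admissible α β) :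
    0 < 𝔼 σ : Matchings d n, (numIndep α β σ : ℝ) := by
  obtain ⟨q, hq, hdisj⟩ := exists_disjoint_mem_sizedPairs hαβ hn
  have hmem : (1 : Matchings d n) ∈ outcomes q.1 q.2 (∅ : Finset (PotentialEdge d n)) :=
    mem_outcomes_empty.2 fun _ _ hu hu' => Finset.disjoint_left.1 hdisj hu hu'
  rw [Fintype.expect_eq_sum_div_card, sum_numIndep]
  refine div_pos (Finset.sum_pos' (fun _ _ => Nat.cast_nonneg _) ⟨q, hq, ?_⟩)
    (Nat.cast_pos.2 Fintype.card_pos)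
  exact Nat.cast_pos.2 (Finset.card_pos.2 ⟨_, hmem⟩)

/-! ### Factorial moments -/

theorem jointFactorialMoments (d : ℕ) {α β : ℝ} (hα : 0 ≤ α) (hβ : 0 ≤ β) (hα1 : α < 1)
    (hβ1 : β < 1) (hαβ : α + β ≤ 1) :
    JointFactorialMoments (Ω := Matchings d) (admissibleAtTop α β) (evenCycles d)
      (indepCount d α β) (evenLam d) (evenDel α β) := by
  intro k m
  rw [Metric.tendsto_nhds]
  intro ε hε
  rw [admissibleAtTop, eventually_inf_principal]
  filter_upwards [eventually_sum_descFactorial d hα hβ hα1 hβ1 m (half_pos hε)] with n hn hadm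
  have hE := expect_numIndep_pos (d := d) hαβ hadm
  have hcard : (0 : ℝ) < Fintype.card (Matchings d n) := Nat.cast_pos.2 Fintype.card_pos
  have hpos : 0 < ∑ σ : Matchings d n, (numIndep α β σ : ℝ) := by
    rwa [Fintype.expect_eq_sum_div_card, div_pos_iff_of_pos_right hcard] at hE
  simp only [indepCount, Fintype.expect_eq_sum_div_card]
  rw [div_div_div_cancel_right₀ hcard.ne', Real.dist_eq, div_sub' hpos.ne', abs_div,
    abs_of_pos hpos, div_lt_iff₀ hpos]
  refine lt_of_le_of_lt ?_ (mul_lt_mul_of_pos_right (half_lt_self hε) hpos)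
  rw [sum_numIndep_mul, sum_numIndep, Finset.sum_mul, ← Finset.sum_sub_distrib, Finset.mul_sum]
  refine (Finset.abs_sum_le_sum_abs _ _).trans (Finset.sum_le_sum fun q hq => ?_)
  rw [mem_sizedPairs] at hq
  rw [mul_comm (Nat.cast _)]
  exact hn q.1 q.2 hq.1 hq.2

theorem admissibleAtTop_zero : admissibleAtTop 0 0 = atTop := by
  have : admissible 0 0 = Set.univ := Set.eq_univ_of_forall fun n => ⟨0, 0, by simp, by simp⟩
  rw [admissibleAtTop, this, principal_univ, inf_top_eq]

theorem numIndep_zero {d n : ℕ} (σ : Matchings d n) : numIndep 0 0 σ = 1 := by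
  rw [numIndep, Set.ncard_eq_one]
  refine ⟨(∅, ∅), Set.ext fun ⟨S, T⟩ => ?_⟩
  simp +contextual [← and_assoc]

/-- The empty set is the only independent set for `α = β = 0`, so `Y = 1` and the joint factorial
moments of the cycle counts alone are a special case. -/
theorem asympIndepPoisson_evenCycles (d : ℕ) :
    AsympIndepPoisson (Ω := Matchings d) atTop (evenCycles d) (evenLam d) := by
  refine asympIndepPoisson_of_tendsto_factorialMoments fun k m => ?_
  have h := jointFactorialMoments d le_rfl le_rfl zero_lt_one zero_lt_one
    (by norm_num : (0 : ℝ) + 0 ≤ 1) k m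
  rw [admissibleAtTop_zero] at h
  simpa [indepCount, numIndep_zero, evenDel, del] using h

theorem tendsto_indep_mul_cycles (d : ℕ) {α β : ℝ} (hα : 0 ≤ α) (hβ : 0 ≤ β) (hα1 : α < 1)
    (hβ1 : β < 1) (hαβ : α + β ≤ 1) {ℓ : ℕ} (hℓ : Even ℓ) (hℓ0 : ℓ ≠ 0) :
    Tendsto
      (fun n : ℕ => (𝔼 σ : Matchings d n, (numIndep α β σ : ℝ) * (numCycles ℓ σ : ℝ)) /
        (𝔼 σ : Matchings d n, (numIndep α β σ : ℝ)))
      (admissibleAtTop α β) (𝓝 (lam d ℓ * (1 + del α β ℓ))) := by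
  obtain ⟨i, rfl⟩ : ∃ i, ℓ = 2 * (i + 1) := by
    obtain ⟨r, rfl⟩ := hℓ
    exact ⟨r - 1, by omega⟩
  have hprod {f : Fin (i + 1) → ℕ → ℝ} (hf : ∀ j, f j 0 = 1) :
      ∏ j, f j ((Pi.single (Fin.last i) 1 : Fin (i + 1) → ℕ) j) = f (Fin.last i) 1 := by
    rw [Fintype.prod_eq_single (Fin.last i) fun j hj => by rw [Pi.single_eq_of_ne hj, hf],
      Pi.single_eq_same]
  have h := jointFactorialMoments d hα hβ hα1 hβ1 hαβ (i + 1) (Pi.single (Fin.last i) 1)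
  have hX (n : ℕ) (σ : Matchings d n) :=
    hprod (f := fun j e => ((evenCycles d n j σ).descFactorial e : ℝ)) fun _ => by simp
  have hμ := hprod (f := fun j e => (evenLam d j * (1 + evenDel α β j)) ^ e) fun _ => pow_zero _
  simp only [hX, hμ] at h
  simpa [indepCount, evenCycles, evenLam, evenDel] using h

/-! ### The second moment -/

theorem sq_expect_le_expect_sq {Ω : Type*} [Fintype Ω] [Nonempty Ω] (f : Ω → ℝ) :
    (𝔼 ω, f ω) ^ 2 ≤ 𝔼 ω, f ω ^ 2 := by
  simpa using Finset.expect_mul_sq_le_sq_mul_sq Finset.univ f fun _ => 1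

theorem one_le_second_moment_ratio {d n : ℕ} {α β : ℝ} (hαβ : α + β ≤ 1)
    (hn : n ∈ admissible α β) :
    1 ≤ (𝔼 σ : Matchings d n, (numIndep α β σ : ℝ) ^ 2) /
      (𝔼 σ : Matchings d n, (numIndep α β σ : ℝ)) ^ 2 := by
  rw [one_le_div (pow_pos (expect_numIndep_pos hαβ hn) 2)]
  exact sq_expect_le_expect_sq _

theorem eventually_admissibleAtTop_of_forall {α β : ℝ} {p : ℕ → Prop}
    (h : ∀ n ∈ admissible α β, p n) : ∀ᶠ n in admissibleAtTop α β, p n :=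
  eventually_inf_principal.2 (Eventually.of_forall h)

theorem neBot_admissibleAtTop {α β : ℝ} (hinf : (admissible α β).Infinite) :
    (admissibleAtTop α β).NeBot :=
  frequently_mem_iff_neBot.1 (Nat.frequently_atTop_iff_infinite.2 hinf)

/-- For a nonpositive discriminant the last square root in `tau` vanishes, so that `tau = 0` by the
convention `x / 0 = 0`, whereas the ratio of moments is at least `1`. -/
theorem discriminant_pos_of_secondMomentLimit {d : ℕ} {α β : ℝ} (hαβ : α + β ≤ 1)
    (hinf : (admissible α β).Infinite) (h : SecondMomentLimit d α β) :
    0 < 1 - α - β - (d - 2) * α * β := by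
  by_contra! hle
  have hτ : tau d α β = 0 := by simp [tau, Real.sqrt_eq_zero_of_nonpos hle]
  have := neBot_admissibleAtTop hinf
  have : (1 : ℝ) ≤ tau d α β :=
    ge_of_tendsto h
      (eventually_admissibleAtTop_of_forall fun _ => one_le_second_moment_ratio hαβ)
  linarith

theorem evenLam_eq (d i : ℕ) :
    evenLam d i = (((d : ℝ) - 1) ^ (2 * (i + 1)) + (d - 1)) / (2 * (i + 1)) := by
  have h := properColorings_succ_eq ℝ d (2 * i + 1)
  rw [Even.neg_one_pow ⟨i + 1, by ring⟩, mul_one] at h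
  rw [evenLam, lam, show 2 * (i + 1) = 2 * i + 1 + 1 by ring, h]
  push_cast
  ring

theorem evenLam_pos {d : ℕ} (hd : 2 ≤ d) (i : ℕ) : 0 < evenLam d i := by
  have hd' : (2 : ℝ) ≤ d := by exact_mod_cast hd
  have : 0 < (d : ℝ) - 1 := by linarith
  rw [evenLam_eq]
  positivity

theorem evenDel_eq (α β : ℝ) (i : ℕ) :
    evenDel α β i = (α * β / ((1 - α) * (1 - β))) ^ (i + 1) := by
  rw [evenDel, del, Nat.mul_div_cancel_left _ two_pos]

theorem evenDel_nonneg {α β : ℝ} (hα : 0 ≤ α) (hβ : 0 ≤ β) (hα1 : α ≤ 1) (hβ1 : β ≤ 1) (i : ℕ) :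
    0 ≤ evenDel α β i := by
  have := sub_nonneg.2 hα1
  have := sub_nonneg.2 hβ1
  rw [evenDel_eq]
  positivity

theorem hasSum_even_pow_mul_sq {D q : ℝ} (hDq : |D * q| < 1) (hq : |q| < 1) :
    HasSum (fun i : ℕ => (D ^ (2 * (i + 1)) + D) / (2 * (i + 1)) * (q ^ (i + 1)) ^ 2)
      (-(Real.log (1 - (D * q) ^ 2) + D * Real.log (1 - q ^ 2)) / 2) := by
  have hlog {x : ℝ} (hx : |x| < 1) :
      HasSum (fun i : ℕ => (x ^ 2) ^ (i + 1) / (i + 1)) (-Real.log (1 - x ^ 2)) :=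
    Real.hasSum_pow_div_log_of_abs_lt_one
      (by rw [abs_pow]; exact pow_lt_one₀ (abs_nonneg x) hx two_ne_zero)
  have hterm (i : ℕ) : 1 / 2 * (((D * q) ^ 2) ^ (i + 1) / (i + 1)) +
      D / 2 * ((q ^ 2) ^ (i + 1) / (i + 1)) =
        (D ^ (2 * (i + 1)) + D) / (2 * (i + 1)) * (q ^ (i + 1)) ^ 2 := by
    rw [pow_mul, mul_pow, mul_pow]
    field_simp
    ring
  have h := ((hlog hDq).mul_left (1 / 2)).add ((hlog hq).mul_left (D / 2))
  simp only [hterm] at h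
  convert! h using 1
  ring

theorem one_sub_sq_mul_div {α β : ℝ} (hα : α ≠ 1) (hβ : β ≠ 1) (D : ℝ) :
    1 - (D * (α * β / ((1 - α) * (1 - β)))) ^ 2 =
      (1 - α - β - (D - 1) * α * β) * (1 - α - β + (D + 1) * α * β) /
        ((1 - α) * (1 - β)) ^ 2 := by
  have := sub_ne_zero.2 hα.symm
  have := sub_ne_zero.2 hβ.symm
  field_simp
  ring

theorem mul_div_one_sub_mul_one_sub_lt_one {α β : ℝ} (hα : α < 1) (hβ : β < 1)
    (hαβ : α + β < 1) : α * β / ((1 - α) * (1 - β)) < 1 := by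
  rw [div_lt_one (mul_pos (sub_pos.2 hα) (sub_pos.2 hβ))]
  linarith

section Tau

variable {d : ℕ} {α β : ℝ}

theorem abs_mul_div_lt_one (hα : 0 ≤ α) (hβ : 0 ≤ β) (hαβ : α + β < 1)
    (hdisc : 0 < 1 - α - β - (d - 2) * α * β) :
    |((d : ℝ) - 1) * (α * β / ((1 - α) * (1 - β)))| < 1 := by
  have hP : 0 < (1 - α) * (1 - β) := mul_pos (by linarith) (by linarith)
  have hdm : 0 ≤ d * (α * β) := by positivity
  rw [← mul_div_assoc, abs_lt, lt_div_iff₀ hP, div_lt_one hP]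
  constructor <;> linarith

theorem tau_pos (hα : 0 ≤ α) (hβ : 0 ≤ β) (hαβ : α + β < 1)
    (hdisc : 0 < 1 - α - β - (d - 2) * α * β) : 0 < tau d α β := by
  have hB : 0 < 1 - α - β := by linarith
  rw [tau]
  positivity

theorem log_tau (hα : 0 ≤ α) (hβ : 0 ≤ β) (hαβ : α + β < 1)
    (hdisc : 0 < 1 - α - β - (d - 2) * α * β) :
    Real.log (tau d α β) =
      -(Real.log (1 - (((d : ℝ) - 1) * (α * β / ((1 - α) * (1 - β)))) ^ 2) +
        (d - 1) * Real.log (1 - (α * β / ((1 - α) * (1 - β))) ^ 2)) / 2 := by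
  have hα1 : α ≠ 1 := by rintro rfl; linarith
  have hβ1 : β ≠ 1 := by rintro rfl; linarith
  have hB : 0 < 1 - α - β := by linarith
  have hA : 0 < 1 - α - β + 2 * α * β := by positivity
  have hE : 0 < 1 - α - β + d * α * β := by positivity
  have hP : 0 < 1 - α - β + α * β := by positivity
  have hPsq : (1 - α) * (1 - β) = 1 - α - β + α * β := by ring
  have hfactor := one_sub_sq_mul_div hα1 hβ1 ((d : ℝ) - 1)
  have hfactor_one := one_sub_sq_mul_div hα1 hβ1 1
  rw [sub_add_cancel, sub_sub (d : ℝ), one_add_one_eq_two, hPsq] at hfactor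
  rw [one_mul, sub_self, zero_mul, zero_mul, sub_zero, one_add_one_eq_two, hPsq] at hfactor_one
  rw [hPsq, hfactor, hfactor_one, tau]
  set A := 1 - α - β + 2 * α * β
  set E := 1 - α - β + d * α * β
  set P := 1 - α - β + α * β
  set G := 1 - α - β - (d - 2) * α * β
  set B := 1 - α - β
  rw [Real.log_div (by positivity) (by positivity), Real.log_mul (by positivity) (by positivity),
    Real.log_mul (by positivity) (by positivity), Real.log_mul (by positivity) (by positivity),
    Real.log_rpow hA, Real.log_rpow hB, Real.log_sqrt hE.le, Real.log_sqrt hdisc.le,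
    Real.log_div (by positivity) (by positivity), Real.log_div (by positivity) (by positivity),
    Real.log_mul (by positivity) (by positivity), Real.log_mul (by positivity) (by positivity),
    Real.log_pow, Real.log_pow]
  push_cast
  ring

theorem hasSum_evenLam_mul_evenDel_sq (hα : 0 ≤ α) (hβ : 0 ≤ β) (hαβ : α + β < 1)
    (hdisc : 0 < 1 - α - β - (d - 2) * α * β) :
    HasSum (fun i => evenLam d i * evenDel α β i ^ 2) (Real.log (tau d α β)) := by
  have hq : |α * β / ((1 - α) * (1 - β))| < 1 := by
    have : 0 < (1 - α) * (1 - β) := mul_pos (by linarith) (by linarith)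
    rw [abs_of_nonneg (by positivity)]
    exact mul_div_one_sub_mul_one_sub_lt_one (by linarith) (by linarith) hαβ
  rw [log_tau hα hβ hαβ hdisc]
  simpa only [evenLam_eq, evenDel_eq] using
    hasSum_even_pow_mul_sq (abs_mul_div_lt_one hα hβ hαβ hdisc) hq

theorem smallSubgraphConditions (hd : 2 ≤ d) (hα : 0 ≤ α) (hβ : 0 ≤ β) (hαβ : α + β < 1)
    (hinf : (admissible α β).Infinite) (h : SecondMomentLimit d α β) :
    SmallSubgraphConditions (Ω := Matchings d) (admissibleAtTop α β) (evenCycles d)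
      (indepCount d α β) (evenLam d) (evenDel α β) := by
  have hα1 : α < 1 := by linarith
  have hβ1 : β < 1 := by linarith
  have hdisc := discriminant_pos_of_secondMomentLimit hαβ.le hinf h
  have hsum := hasSum_evenLam_mul_evenDel_sq hα hβ hαβ hdisc
  have hle : admissibleAtTop α β ≤ atTop := inf_le_left
  have hpoisson := asympIndepPoisson_evenCycles d
  exact {
    mean_pos := evenLam_pos hd
    delta_gt := fun i => neg_one_lt_zero.trans_le (evenDel_nonneg hα hβ hα1.le hβ1.le i)
    nonneg := fun _ _ => Nat.cast_nonneg _
    expect_pos := eventually_admissibleAtTop_of_forall fun _ => expect_numIndep_pos hαβ.le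
    poisson := ⟨fun i => (hpoisson.1 i).mono_left hle, fun k a => (hpoisson.2 k a).mono_left hle⟩
    moments := jointFactorialMoments d hα hβ hα1 hβ1 hαβ.le
    summable := hsum.summable
    second_moment := fun ε hε => by
      rw [hsum.tsum_eq, Real.exp_log (tau_pos hα hβ hαβ hdisc)]
      exact (h.eventually_lt_const (lt_add_of_pos_right _ hε)).mono fun n hn => hn.le }

end Tau

end BipartiteHardCore

end

open BipartiteHardCore in
theorem mainTheorem7_general (d : ℕ) (α β : ℝ) (hα : 0 ≤ α) (hβ : 0 ≤ β) (hαβ : α + β < 1)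
    (hinf : (admissible α β).Infinite) :
    AsympIndepPoisson (Ω := Matchings d) atTop (evenCycles d) (evenLam d) ∧
    (∀ ℓ : ℕ, Even ℓ → 2 ≤ ℓ →
      Tendsto
        (fun n : ℕ => (𝔼 σ : Matchings d n, (numIndep α β σ : ℝ) * (numCycles ℓ σ : ℝ)) /
          (𝔼 σ : Matchings d n, (numIndep α β σ : ℝ)))
        (admissibleAtTop α β) (𝓝 (lam d ℓ * (1 + del α β ℓ)))) ∧
    (∀ ℓ : ℕ, Even ℓ → 2 ≤ ℓ →
      1 + del α β ℓ = stepWeight α β ^ ℓ * (transferMatrix α β ^ ℓ).trace / 2) ∧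
    JointFactorialMoments (Ω := Matchings d) (admissibleAtTop α β) (evenCycles d)
      (indepCount d α β) (evenLam d) (evenDel α β) ∧
    (2 ≤ d → SecondMomentLimit d α β →
      SmallSubgraphConditions (Ω := Matchings d) (admissibleAtTop α β) (evenCycles d)
        (indepCount d α β) (evenLam d) (evenDel α β)) := by
  have hα1 : α < 1 := by linarith
  have hβ1 : β < 1 := by linarith
  have hB : 1 - α - β ≠ 0 := by linarith
  exact ⟨asympIndepPoisson_evenCycles d,
    fun ℓ hℓ h2 => tendsto_indep_mul_cycles d hα hβ hα1 hβ1 hαβ.le hℓ (by omega),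
    fun ℓ hℓ _ => one_add_del_eq_trace hα1 hβ1 hB hℓ,
    jointFactorialMoments d hα hβ hα1 hβ1 hαβ.le,
    fun hd => smallSubgraphConditions hd hα hβ hαβ hinf⟩

open BipartiteHardCore in
theorem mainTheorem7 (d : ℕ) (hd : 3 ≤ d) (α β : ℝ) (hα : 0 ≤ α) (hβ : 0 ≤ β)
    (hαβ : α + β < 1) (hinf : (admissible α β).Infinite) :
    AsympIndepPoisson (Ω := Matchings d) atTop (evenCycles d) (evenLam d) ∧
    (∀ ℓ : ℕ, Even ℓ → 2 ≤ ℓ →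
      Tendsto
        (fun n : ℕ => (𝔼 σ : Matchings d n, (numIndep α β σ : ℝ) * (numCycles ℓ σ : ℝ)) /
          (𝔼 σ : Matchings d n, (numIndep α β σ : ℝ)))
        (admissibleAtTop α β) (𝓝 (lam d ℓ * (1 + del α β ℓ)))) ∧
    (∀ ℓ : ℕ, Even ℓ → 2 ≤ ℓ →
      1 + del α β ℓ = stepWeight α β ^ ℓ * (transferMatrix α β ^ ℓ).trace / 2) ∧
    JointFactorialMoments (Ω := Matchings d) (admissibleAtTop α β) (evenCycles d)
      (indepCount d α β) (evenLam d) (evenDel α β) ∧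
    (SecondMomentLimit d α β →
      SmallSubgraphConditions (Ω := Matchings d) (admissibleAtTop α β) (evenCycles d)
        (indepCount d α β) (evenLam d) (evenDel α β)) := by
  obtain ⟨hpoisson, hratio, htrace, hmoments, hconditions⟩ :=
    mainTheorem7_general d α β hα hβ hαβ hinf
  exact ⟨hpoisson, hratio, htrace, hmoments, hconditions (by omega)⟩
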